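/- **Theorem (extension of local $h$-Killing fields).** Let $(U,g)$ be a connected, real-analytic Riemannian manifold (Hausdorff, without boundary, of finite dimension $n\ge 0$), and let $h$ be a real-analytic symmetric $(0,2)$-tensor field on $U$. Let $\Omega\subset U$ be a nonempty connected open subset with $\pi_1(U,\Omega)=0$, that is, $\Omega$ is connected and, for every base point in $\Omega$, the inclusion $\Omega\hookrightarrow U$ induces a surjection $\pi_1(\Omega)\to\pi_1(U)$. Call a vector field $X$ on an open set *$h$-Killing* there if $L_X g=h$ there, i.e. $$X\big(g(Y,Z)\big)-g([X,Y],Z)-g(Y,[X,Z])=h(Y,Z)$$ for all smooth vector fields $Y,Z$. Let $2\le k\le\omega$, where $k$ is an integer, $k=\infty$ (smooth) or $k=\omega$ (real-analytic). Then for every $h$-Killing vector field $X$ of class $C^k$ on $\Omega$ there is exactly one $h$-Killing vector field $\hat X$ of class $C^k$ on all of $U$ with $\hat X=X$ on $\Omega$. -/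

import Mathlib

open scoped Manifold ContDiff Topology Bundle

section HKilling

variable {n : ℕ} {M : Type*} [TopologicalSpace M] [ChartedSpace (EuclideanSpace ℝ (Fin n)) M]
  [IsManifold (𝓡 n) ω M]

/-- The value at `p` of `(L_X T)(Y, Z) = X (T(Y, Z)) - T([X, Y], Z) - T(Y, [X, Z])`, the Lie
derivative of the `(0,2)`-tensor field `T` along the vector field `X`, evaluated on the vector
fields `Y` and `Z`. -/
noncomputable def lieDerivEval
    (X : ∀ x : M, TangentSpace (𝓡 n) x)
    (T : ∀ x : M, TangentSpace (𝓡 n) x →L[ℝ] TangentSpace (𝓡 n) x →L[ℝ] ℝ)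
    (Y Z : ∀ x : M, TangentSpace (𝓡 n) x) (p : M) : ℝ :=
  mvfderiv (𝓡 n) (fun x => T x (Y x) (Z x)) p (X p)
    - T p (VectorField.mlieBracket (𝓡 n) X Y p) (Z p)
    - T p (Y p) (VectorField.mlieBracket (𝓡 n) X Z p)

/-- A vector field `X` is of class `C^k` on the set `s`. -/
def IsCkVectorFieldOn (k : ℕ∞ω) (X : ∀ x : M, TangentSpace (𝓡 n) x) (s : Set M) : Prop :=
  ContMDiffOn (𝓡 n) (𝓡 n).tangent k
    (fun x => (⟨x, X x⟩ : TangentBundle (𝓡 n) M)) s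

/-- `L_X T = h` at every point of the (open) set `s`: the two tensors agree at `p ∈ s` on all
vector fields `Y`, `Z` that are smooth at `p`. -/
def LieDerivEqOn
    (X : ∀ x : M, TangentSpace (𝓡 n) x)
    (T h : ∀ x : M, TangentSpace (𝓡 n) x →L[ℝ] TangentSpace (𝓡 n) x →L[ℝ] ℝ)
    (s : Set M) : Prop :=
  ∀ p ∈ s, ∀ Y Z : ∀ x : M, TangentSpace (𝓡 n) x,
    ContMDiffAt (𝓡 n) (𝓡 n).tangent ∞ (fun x => (⟨x, Y x⟩ : TangentBundle (𝓡 n) M)) p →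
    ContMDiffAt (𝓡 n) (𝓡 n).tangent ∞ (fun x => (⟨x, Z x⟩ : TangentBundle (𝓡 n) M)) p →
    lieDerivEval X T Y Z p = h p (Y p) (Z p)

/-- An analytic symmetric `(0,2)`-tensor field on an analytic manifold. -/
structure IsAnalyticSymmTensor
    (h : ∀ x : M, TangentSpace (𝓡 n) x →L[ℝ] TangentSpace (𝓡 n) x →L[ℝ] ℝ) : Prop where
  symm : ∀ (x : M) (v w : TangentSpace (𝓡 n) x), h x v w = h x w v
  analytic : ContMDiff (𝓡 n)
    ((𝓡 n).prod 𝓘(ℝ, EuclideanSpace ℝ (Fin n) →L[ℝ] EuclideanSpace ℝ (Fin n) →L[ℝ] ℝ)) ω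
    (fun x => Bundle.TotalSpace.mk'
      (EuclideanSpace ℝ (Fin n) →L[ℝ] EuclideanSpace ℝ (Fin n) →L[ℝ] ℝ)
      (E := fun x : M => TangentSpace (𝓡 n) x →L[ℝ] TangentSpace (𝓡 n) x →L[ℝ] ℝ) x (h x))

/-- `X` is a `C^k` vector field on the open set `s` with `L_X g = h` there. -/
structure IsHKillingOn (k : ℕ∞ω)
    (g : Bundle.ContMDiffRiemannianMetric (𝓡 n) ω (EuclideanSpace ℝ (Fin n))
      (fun x : M => TangentSpace (𝓡 n) x))
    (h : ∀ x : M, TangentSpace (𝓡 n) x →L[ℝ] TangentSpace (𝓡 n) x →L[ℝ] ℝ)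
    (X : ∀ x : M, TangentSpace (𝓡 n) x) (s : Set M) : Prop where
  contMDiffOn : IsCkVectorFieldOn k X s
  lieDeriv_eq : LieDerivEqOn X g.inner h s

end HKilling

/-- `π₁(M, S) = 0`: the subset `S` is connected and, for every base point in `S`, the inclusion
`S → M` induces a surjection `π₁(S) → π₁(M)`. -/
def RelFundamentalGroupTrivial {M : Type*} [TopologicalSpace M] (S : Set M) : Prop :=
  IsConnected S ∧ ∀ x : S, Function.Surjective
    (FundamentalGroup.map (⟨Subtype.val, continuous_subtype_val⟩ : C(S, M)) x)

/-! The equation `L_X g = h` is of finite type. In a chart it says that the derivative of `g` along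
`X`, plus `g(DX v, w) + g(v, DX w)`, equals `h(v, w)`. Differentiating once expresses the
symmetrisation in `Y, Z` of `B(V; Y, Z) = g(D²X(V, Y), Z)` through `X` and `DX`. Since `B` is
symmetric in `V, Y`, Koszul's cyclic trick (`koszul_eq`) recovers `B`, and inverting `g` gives `D²X`
as an affine function of `(X, DX)` with analytic coefficients. So `y = (X, DX)` solves a closed
linear system `Dy = Θ y + β` (`FlatLieDerivEqOn.prolongation`).

Restricted to a segment from `p` to `x`, this system is a linear ODE. Its value at the end of the
segment depends only on `y(p)` and is analytic in `x`, on a ball around `q` whose size depends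
neither on `p` nor on `y(p)` (`exists_analytic_continuation_of_closed_system`). This candidate
agrees with `(X, DX)` near `p`. No integrability condition has to be checked: its first component
satisfies the original equation near `p`, hence on the whole ball by the identity theorem.
Uniqueness holds because `y(p)` determines the solution (`exists_ball_flat_continuation`). In
particular `h`-Killing fields of class `C^2` are analytic, so it suffices to extend in class `ω`.

Germs of `h`-Killing fields therefore form a locally constant sheaf, whose étalé space covers the
manifold (`isCoveringMap_proj`). The given field is a section of this covering over `Ω`.
Surjectivity of `π₁(Ω) → π₁(M)` is what the lifting criterion needs to lift the identity of `M`
through the germ of the field at a point of `Ω`. The lift is the global extension, and uniqueness of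
lifts gives uniqueness of the extension. -/

/-! ### Étalé space of germs and the monodromy theorem -/

section Continuation

set_option maxSynthPendingDepth 3

open Set Filter

variable {M F : Type*} [TopologicalSpace M]

/-- A sheaf of functions such that every point has a neighbourhood `W` on which every germ at
a point of `W` has exactly one extension: the solutions form a locally constant sheaf. -/
structure IsLocallyConstantSheaf (Sol : (M → F) → Set M → Prop) : Prop where
  mono : ∀ {X : M → F} {U V : Set M}, IsOpen V → V ⊆ U → Sol X U → Sol X V
  local' : ∀ {X : M → F} {U : Set M}, IsOpen U →
    (∀ x ∈ U, ∃ V, IsOpen V ∧ x ∈ V ∧ ∃ Y, Sol Y V ∧ EqOn X Y V) → Sol X U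
  exists_extension : ∀ q : M, ∃ W, IsOpen W ∧ q ∈ W ∧
    (∀ p ∈ W, ∀ N, IsOpen N → p ∈ N → ∀ X, Sol X N → ∃ Y, Sol Y W ∧ Y =ᶠ[𝓝 p] X) ∧
    (∀ p ∈ W, ∀ X Y, Sol X W → Sol Y W → X =ᶠ[𝓝 p] Y → EqOn X Y W)

/-- The étalé space of germs of solutions. -/
def SolutionGerm (Sol : (M → F) → Set M → Prop) : Type _ :=
  {e : Σ p : M, Germ (𝓝 p) F //
    ∃ U, IsOpen U ∧ e.1 ∈ U ∧ ∃ X, Sol X U ∧ e.2 = (X : Germ (𝓝 e.1) F)}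

namespace SolutionGerm

variable {Sol : (M → F) → Set M → Prop}

/-- The base point of a germ. -/
def proj (e : SolutionGerm Sol) : M := e.1.1

/-- The value of a germ at its base point. -/
def value (e : SolutionGerm Sol) : F := e.1.2.value

/-- The section of the étalé space that a solution defines. -/
def sec {U : Set M} (hU : IsOpen U) {X : M → F} (hX : Sol X U) (p : U) : SolutionGerm Sol :=
  ⟨⟨p, (X : Germ (𝓝 (p : M)) F)⟩, U, hU, p.2, X, hX, rfl⟩

instance : TopologicalSpace (SolutionGerm Sol) :=
  ⨆ s : {s : Set M × (M → F) // IsOpen s.1 ∧ Sol s.2 s.1},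
    TopologicalSpace.coinduced (sec s.2.1 s.2.2) inferInstance

theorem isOpen_iff {A : Set (SolutionGerm Sol)} :
    IsOpen A ↔ ∀ (U : Set M) (hU : IsOpen U) (X : M → F) (hX : Sol X U),
      IsOpen (sec hU hX ⁻¹' A) := by
  refine isOpen_iSup_iff.trans ?_
  simp only [isOpen_coinduced]
  exact ⟨fun h U hU X hX => h ⟨(U, X), hU, hX⟩, fun h s => h _ _ _ _⟩

theorem continuous_sec {U : Set M} (hU : IsOpen U) {X : M → F} (hX : Sol X U) :
    Continuous (sec hU hX) :=
  continuous_def.2 fun _ hA => isOpen_iff.1 hA U hU X hX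

theorem continuous_proj : Continuous (proj : SolutionGerm Sol → M) :=
  continuous_def.2 fun _ hA => isOpen_iff.2 fun _ _ _ _ => hA.preimage continuous_subtype_val

theorem sec_eq_sec_iff {U V : Set M} (hU : IsOpen U) (hV : IsOpen V) {X Y : M → F}
    (hX : Sol X U) (hY : Sol Y V) (p : U) (q : V) :
    sec hU hX p = sec hV hY q ↔ (p : M) = q ∧ X =ᶠ[𝓝 (p : M)] Y := by
  obtain ⟨p, hp⟩ := p
  obtain ⟨q, hq⟩ := q
  constructor
  · intro h
    have h1 : (⟨p, (X : Germ (𝓝 p) F)⟩ : Σ p : M, Germ (𝓝 p) F) = ⟨q, (Y : Germ (𝓝 q) F)⟩ :=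
      congrArg Subtype.val h
    obtain rfl : p = q := congrArg Sigma.fst h1
    exact ⟨rfl, Germ.coe_eq.1 (eq_of_heq (Sigma.mk.inj h1).2)⟩
  · rintro ⟨rfl : p = q, h⟩
    exact Subtype.ext (Sigma.ext rfl (heq_of_eq (Germ.coe_eq.2 h)))

/-- Having equal germs at a point is an open condition on the point, so two sections meet over an
open set. -/
theorem isOpen_sec_image {U : Set M} (hU : IsOpen U) {X : M → F} (hX : Sol X U) {A : Set U}
    (hA : IsOpen A) : IsOpen (sec hU hX '' A) := by
  refine isOpen_iff.2 fun V hV Y hY => ?_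
  have : sec hV hY ⁻¹' (sec hU hX '' A) =
      Subtype.val ⁻¹' ((Subtype.val '' A) ∩ {p : M | ∀ᶠ x in 𝓝 p, X x = Y x}) := by
    ext q
    constructor
    · rintro ⟨p, hp, hpq⟩
      obtain ⟨h1, h2⟩ := (sec_eq_sec_iff hU hV hX hY p q).1 hpq
      rw [mem_preimage, ← h1]
      exact ⟨mem_image_of_mem _ hp, h2⟩
    · rintro ⟨⟨p, hp, hpq⟩, h⟩
      refine ⟨p, hp, (sec_eq_sec_iff hU hV hX hY p q).2 ⟨hpq, ?_⟩⟩
      rw [hpq]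
      exact h
  rw [this]
  exact ((hU.isOpenMap_subtype_val _ hA).inter isOpen_setOfPred_eventually_nhds).preimage
    continuous_subtype_val

theorem exists_eq_sec (e : SolutionGerm Sol) :
    ∃ (U : Set M) (hU : IsOpen U) (X : M → F) (hX : Sol X U) (hp : e.proj ∈ U),
      e = sec hU hX ⟨e.proj, hp⟩ := by
  obtain ⟨⟨p, s⟩, U, hU, hp, X, hX, h⟩ := e
  exact ⟨U, hU, X, hX, hp, Subtype.ext (Sigma.ext rfl (heq_of_eq h))⟩

/-- Over a neighbourhood `W` as in `exists_extension`, each germ lies on the section of exactly one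
solution on `W`, so these sections are the sheets. -/
theorem isCoveringMap_proj (hS : IsLocallyConstantSheaf Sol) :
    IsCoveringMap (proj : SolutionGerm Sol → M) := by
  intro q
  obtain ⟨W, hW, hqW, hext, huniq⟩ := hS.exists_extension q
  -- Sheets are indexed by restrictions to `W`: a solution is a function on all of `M`, and its
  -- values off `W` would make the indexing non-injective.
  let I := {s : W → F // ∃ X, Sol X W ∧ ∀ x : W, X x = s x}
  let : TopologicalSpace I := ⊥
  have : DiscreteTopology I := ⟨rfl⟩
  choose ext hext_sol hext_eq using fun s : I => s.2
  have hWpre : IsOpen (proj ⁻¹' W : Set (SolutionGerm Sol)) := hW.preimage continuous_proj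
  let φ : W × I → (proj ⁻¹' W : Set (SolutionGerm Sol)) := fun z =>
    ⟨sec hW (hext_sol z.2) z.1, z.1.2⟩
  have hφ_cont : Continuous φ := by
    refine Continuous.subtype_mk ?_ _
    rw [continuous_prod_of_discrete_right]
    exact fun s => continuous_sec hW (hext_sol s)
  have hφ_open : IsOpenMap φ := by
    intro A hA
    have : φ '' A = Subtype.val ⁻¹'
        ⋃ s : I, sec hW (hext_sol s) '' {x | (x, s) ∈ A} := by
      ext e
      simp only [mem_image, mem_preimage, mem_iUnion]
      constructor
      · rintro ⟨⟨x, s⟩, h, rfl⟩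
        exact ⟨s, x, h, rfl⟩
      · rintro ⟨s, x, h, h'⟩
        exact ⟨(x, s), h, Subtype.ext h'⟩
    rw [this]
    exact (isOpen_iUnion fun s => isOpen_sec_image hW (hext_sol s)
      (hA.preimage (by fun_prop))).preimage continuous_subtype_val
  have hφ_bij : Function.Bijective φ := by
    constructor
    · rintro ⟨x, s⟩ ⟨y, t⟩ h
      obtain ⟨h1, h2⟩ :=
        (sec_eq_sec_iff hW hW (hext_sol s) (hext_sol t) x y).1 (congrArg Subtype.val h)
      refine Prod.ext (Subtype.ext h1) (Subtype.ext (funext fun z => ?_))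
      rw [← hext_eq s, ← hext_eq t]
      exact huniq x x.2 _ _ (hext_sol s) (hext_sol t) h2 z.2
    · rintro ⟨e, he⟩
      obtain ⟨U, hU, X, hX, hp, hE⟩ := exists_eq_sec e
      obtain ⟨Y, hY, hYX⟩ := hext _ he U hU hp X hX
      let s : I := ⟨fun x => Y x, Y, hY, fun _ => rfl⟩
      refine ⟨(⟨e.proj, he⟩, s), Subtype.ext ?_⟩
      refine Eq.trans ?_ hE.symm
      refine (sec_eq_sec_iff hW hU (hext_sol s) hX ⟨_, he⟩ ⟨_, hp⟩).2 ⟨rfl, ?_⟩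
      filter_upwards [hYX, hW.mem_nhds he] with x hx hxW
      rw [← hx]
      exact hext_eq s ⟨x, hxW⟩
  have : IsEvenlyCovered (proj : SolutionGerm Sol → M) q I :=
    ⟨inferInstance, W, hqW, hW, hWpre,
      ((Equiv.ofBijective φ hφ_bij).toHomeomorphOfContinuousOpen hφ_cont hφ_open).symm, by
      intro e
      obtain ⟨z, rfl⟩ := hφ_bij.2 e
      have : (((Equiv.ofBijective φ hφ_bij).toHomeomorphOfContinuousOpen
        hφ_cont hφ_open).symm (φ z)) = z :=
        ((Equiv.ofBijective φ hφ_bij)).symm_apply_apply z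
      rw [this]
      rfl⟩
  exact this.to_isEvenlyCovered_preimage

end SolutionGerm

namespace IsLocallyConstantSheaf

variable {Sol : (M → F) → Set M → Prop}

open SolutionGerm

/-- Unique continuation. -/
theorem eq_of_eqOn [PreconnectedSpace M] (hS : IsLocallyConstantSheaf Sol) {X Y : M → F}
    (hX : Sol X univ) (hY : Sol Y univ) {Ω : Set M} (hΩ : IsOpen Ω) (hne : Ω.Nonempty)
    (h : EqOn X Y Ω) : X = Y := by
  obtain ⟨a, ha⟩ := hne
  have := isPreconnected_iff_preconnectedSpace.1 (isPreconnected_univ (α := M))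
  -- Both solutions give lifts of the same map to the étalé space; lifts on a connected space that
  -- agree at one point coincide.
  have := (isCoveringMap_proj hS).eq_of_comp_eq (continuous_sec isOpen_univ hX)
    (continuous_sec isOpen_univ hY) rfl ⟨a, mem_univ a⟩
    ((sec_eq_sec_iff _ _ _ _ _ _).2 ⟨rfl, h.eventuallyEq_of_mem (hΩ.mem_nhds ha)⟩)
  funext x
  exact ((sec_eq_sec_iff _ _ _ _ _ _).1 (congrFun this ⟨x, mem_univ x⟩)).2.eq_of_nhds

/-- A continuous section of the étalé space is a global solution. -/
theorem sol_of_continuous_section (hS : IsLocallyConstantSheaf Sol)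
    {s : M → SolutionGerm Sol} (hs : Continuous s) (hproj : ∀ x, (s x).proj = x) :
    Sol (fun x => (s x).value) univ := by
  refine hS.local' isOpen_univ fun x _ => ?_
  obtain ⟨U, hU, X, hX, hp, hE⟩ := exists_eq_sec (s x)
  -- The section `s` stays on the sheet of `X` over an open set, and there its values are those of
  -- `X`.
  have hopen : IsOpen (s ⁻¹' (sec hU hX '' univ)) :=
    (isOpen_sec_image hU hX isOpen_univ).preimage hs
  refine ⟨s ⁻¹' (sec hU hX '' univ) ∩ U, hopen.inter hU, ⟨⟨_, mem_univ _, hE.symm⟩, ?_⟩, X,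
    hS.mono (hopen.inter hU) inter_subset_right hX, ?_⟩
  · rwa [hproj] at hp
  · rintro y ⟨⟨p, -, hpy⟩, -⟩
    have h1 : (p : M) = y := by rw [← hproj y, ← hpy]; rfl
    change (s y).value = X y
    rw [← hpy, ← h1]
    rfl

/-- Monodromy theorem: solutions extend from `Ω` if `π₁(M, Ω) = 0`. -/
theorem exists_extension_univ [PathConnectedSpace M] [LocallyPathConnectedSpace M]
    (hS : IsLocallyConstantSheaf Sol) {Ω : Set M} (hΩ : IsOpen Ω)
    (hπ : RelFundamentalGroupTrivial Ω) {X : M → F} (hX : Sol X Ω) :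
    ∃ Y, Sol Y univ ∧ EqOn Y X Ω := by
  obtain ⟨⟨⟨a, ha⟩, hconn⟩, hsurj⟩ := hπ
  have cov := isCoveringMap_proj hS
  let s : C(Ω, SolutionGerm Sol) := ⟨sec hΩ hX, continuous_sec hΩ hX⟩
  have he : proj (s ⟨a, ha⟩) = (ContinuousMap.id M) a := rfl
  -- Lifting criterion for the identity of `M`: a loop class `γ` in `M` comes from some `δ` in `Ω`,
  -- and the image of `δ` under the section `s` is a class in the étalé space that projects to `γ`.
  obtain ⟨G, ⟨hG0, hGp⟩, -⟩ := cov.existsUnique_continuousMap_lifts_of_range_le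
    (f := ContinuousMap.id M) (a₀ := a) (e₀ := s ⟨a, ha⟩) he (by
      rintro _ ⟨γ, rfl⟩
      obtain ⟨δ, hδ⟩ := hsurj ⟨a, ha⟩ γ
      refine ⟨FundamentalGroup.map s ⟨a, ha⟩ δ, ?_⟩
      rw [FundamentalGroup.mapOfEq_apply, ← hδ]
      obtain ⟨δ, rfl⟩ := Quotient.exists_rep δ
      rfl)
  have hproj : ∀ x, (G x).proj = x := fun x => congrFun hGp x
  refine ⟨_, hS.sol_of_continuous_section G.continuous hproj, fun x hx => ?_⟩
  have : PreconnectedSpace Ω := isPreconnected_iff_preconnectedSpace.1 hconn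
  have := cov.eq_of_comp_eq (A := Ω) (g₁ := fun x => G x) (g₂ := s)
    (G.continuous.comp continuous_subtype_val) s.continuous
    (funext fun x => hproj x) ⟨a, ha⟩ hG0
  have := congrFun this ⟨x, hx⟩
  change (G x).value = X x
  rw [show G x = s ⟨x, hx⟩ from this]
  rfl

end IsLocallyConstantSheaf

end Continuation

/-! ### Closed linear systems: integration along segments, analytic in the endpoint -/

section LinearODE

set_option maxSynthPendingDepth 3

open Set Filter

open unitInterval Metric MeasureTheory BoundedContinuousFunction

variable {E F G H : Type*} [NormedAddCommGroup E] [NormedAddCommGroup F] [NormedAddCommGroup G]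
  [NormedAddCommGroup H]

/-- The Banach space of continuous curves `[0, 1] → G`. -/
def UnitCurve (G : Type*) [NormedAddCommGroup G] : Type _ := I →ᵇ G

namespace UnitCurve

noncomputable instance : NormedAddCommGroup (UnitCurve G) :=
  inferInstanceAs (NormedAddCommGroup (I →ᵇ G))

instance [CompleteSpace G] : CompleteSpace (UnitCurve G) :=
  inferInstanceAs (CompleteSpace (I →ᵇ G))

instance : FunLike (UnitCurve G) I G := inferInstanceAs (FunLike (I →ᵇ G) I G)

theorem continuous (u : UnitCurve G) : Continuous u :=
  BoundedContinuousFunction.continuous (u : I →ᵇ G)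

@[ext]
theorem ext {u v : UnitCurve G} (h : ∀ t, u t = v t) : u = v := DFunLike.ext _ _ h

theorem norm_apply_le (u : UnitCurve G) (t : I) : ‖u t‖ ≤ ‖u‖ :=
  BoundedContinuousFunction.norm_coe_le_norm (u : I →ᵇ G) t

theorem norm_le {u : UnitCurve G} {c : ℝ} (hc : 0 ≤ c) : ‖u‖ ≤ c ↔ ∀ t, ‖u t‖ ≤ c :=
  BoundedContinuousFunction.norm_le (f := (u : I →ᵇ G)) hc

@[simp] theorem add_apply (u v : UnitCurve G) (t : I) : (u + v) t = u t + v t := rfl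

@[simp] theorem sub_apply (u v : UnitCurve G) (t : I) : (u - v) t = u t - v t := rfl

theorem continuous_iccExtend (u : UnitCurve G) : Continuous (IccExtend zero_le_one u) :=
  u.continuous.Icc_extend'

/-- A continuous function on the unit interval as a curve. -/
noncomputable def mk (f : I → G) (hf : Continuous f) : UnitCurve G := mkOfCompact ⟨f, hf⟩

@[simp] theorem mk_apply (f : I → G) (hf : Continuous f) (t : I) : mk f hf t = f t := rfl

variable [NormedSpace ℝ E] [NormedSpace ℝ F] [NormedSpace ℝ G] [NormedSpace ℝ H]

noncomputable instance : NormedSpace ℝ (UnitCurve G) :=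
  inferInstanceAs (NormedSpace ℝ (I →ᵇ G))

@[simp] theorem smul_apply (c : ℝ) (u : UnitCurve G) (t : I) : (c • u) t = c • u t := rfl

/-- Evaluation of curves at a time `t`. -/
noncomputable def eval (t : I) : UnitCurve G →L[ℝ] G :=
  LinearMap.mkContinuous
    { toFun := fun u => u t
      map_add' := fun _ _ => rfl
      map_smul' := fun _ _ => rfl } 1 (fun u => by
    rw [one_mul]
    exact u.norm_apply_le t)

/-- The curve `t ↦ t ^ m • v` as a function of `v`. -/
noncomputable def monomial (m : ℕ) : G →L[ℝ] UnitCurve G :=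
  LinearMap.mkContinuous
    { toFun := fun v => mk (fun t => (t : ℝ) ^ m • v) (by fun_prop)
      map_add' := fun v w => ext fun t => smul_add _ _ _
      map_smul' := fun c v => ext fun t => smul_comm _ _ _ } 1 (fun v => by
    rw [one_mul, norm_le (norm_nonneg v)]
    intro t
    simp only [LinearMap.coe_mk, AddHom.coe_mk, mk_apply, norm_smul, norm_pow]
    refine mul_le_of_le_one_left (norm_nonneg v) (pow_le_one₀ (norm_nonneg _) ?_)
    rw [Real.norm_of_nonneg t.2.1]
    exact t.2.2)

theorem monomial_apply (m : ℕ) (v : G) (t : I) : monomial m v t = (t : ℝ) ^ m • v := rfl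

@[simp] theorem monomial_zero_apply (v : G) (t : I) : monomial 0 v t = v := by
  rw [monomial_apply, pow_zero, one_smul]

theorem norm_monomial_le (m : ℕ) : ‖(monomial m : G →L[ℝ] UnitCurve G)‖ ≤ 1 :=
  LinearMap.mkContinuous_norm_le _ zero_le_one _

/-- A bilinear map applied pointwise to two curves. -/
noncomputable def bilinear (B : H →L[ℝ] E →L[ℝ] G) :
    UnitCurve H →L[ℝ] UnitCurve E →L[ℝ] UnitCurve G :=
  LinearMap.mkContinuous₂
    (LinearMap.mk₂ ℝ (fun (A : UnitCurve H) (u : UnitCurve E) =>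
        mk (fun t => B (A t) (u t)) ((B.continuous.comp A.continuous).clm_apply u.continuous))
      (fun _ _ _ => ext fun _ => by simp) (fun _ _ _ => ext fun _ => by simp)
      (fun _ _ _ => ext fun _ => by simp) (fun _ _ _ => ext fun _ => by simp)) ‖B‖
    (fun A u => by
      rw [norm_le (by positivity)]
      intro t
      refine (B.le_opNorm₂ (A t) (u t)).trans ?_
      gcongr
      exacts [A.norm_apply_le t, u.norm_apply_le t])

@[simp] theorem bilinear_apply (B : H →L[ℝ] E →L[ℝ] G) (A : UnitCurve H) (u : UnitCurve E) (t : I) :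
    bilinear B A u t = B (A t) (u t) := rfl

/-- The primitive of a curve that vanishes at `0`. -/
noncomputable def primitive : UnitCurve F →L[ℝ] UnitCurve F :=
  LinearMap.mkContinuous
    { toFun := fun u => mk (fun t => ∫ s in (0 : ℝ)..t, IccExtend zero_le_one u s)
        ((intervalIntegral.continuous_primitive (fun a b =>
          u.continuous_iccExtend.intervalIntegrable a b) 0).comp continuous_subtype_val)
      map_add' := fun u v => ext fun t =>
        intervalIntegral.integral_add (u.continuous_iccExtend.intervalIntegrable _ _)
          (v.continuous_iccExtend.intervalIntegrable _ _)
      map_smul' := fun c u => ext fun t =>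
        intervalIntegral.integral_smul c (IccExtend zero_le_one u) } 1 (fun u => by
    rw [one_mul, norm_le (norm_nonneg u)]
    intro t
    refine (intervalIntegral.norm_integral_le_of_norm_le_const (C := ‖u‖)
      fun s _ => u.norm_apply_le _).trans ?_
    rw [sub_zero, abs_of_nonneg t.2.1]
    exact mul_le_of_le_one_right (norm_nonneg _) t.2.2)

theorem primitive_apply (u : UnitCurve F) (t : I) :
    primitive u t = ∫ s in (0 : ℝ)..t, IccExtend zero_le_one u s := rfl

theorem norm_primitive_apply_le (u : UnitCurve F) : ‖primitive u‖ ≤ ‖u‖ :=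
  (primitive.le_of_opNorm_le (LinearMap.mkContinuous_norm_le _ zero_le_one _) u).trans_eq
    (one_mul _)

/-- The Volterra operator `u ↦ (t ↦ ∫ s in 0..t, B (A s) (u s))`. -/
noncomputable def volterra (B : H →L[ℝ] F →L[ℝ] F) :
    UnitCurve H →L[ℝ] UnitCurve F →L[ℝ] UnitCurve F :=
  (ContinuousLinearMap.compL ℝ (UnitCurve F) (UnitCurve F) (UnitCurve F) primitive).comp
    (bilinear B)

theorem volterra_apply (B : H →L[ℝ] F →L[ℝ] F) (A : UnitCurve H) (u : UnitCurve F) :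
    volterra B A u = primitive (bilinear B A u) := rfl

theorem norm_volterra_le {B : H →L[ℝ] F →L[ℝ] F} {A : UnitCurve H} {c : ℝ} (hc : 0 ≤ c)
    (h : ∀ t, ‖B (A t)‖ ≤ c) : ‖volterra B A‖ ≤ c := by
  refine ContinuousLinearMap.opNorm_le_bound _ hc fun u => ?_
  rw [volterra_apply]
  refine (norm_primitive_apply_le _).trans ?_
  rw [norm_le (by positivity)]
  intro t
  refine ((B (A t)).le_opNorm (u t)).trans ?_
  gcongr
  exacts [h t, u.norm_apply_le t]

end UnitCurve

open UnitCurve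

variable [NormedSpace ℝ E] [NormedSpace ℝ F] [NormedSpace ℝ G] [NormedSpace ℝ H]

theorem norm_compContinuousMultilinearMap_le_of_norm_le_one {L : G →L[ℝ] F} (hL : ‖L‖ ≤ 1)
    {m : ℕ} (P : ContinuousMultilinearMap ℝ (fun _ : Fin m => E) G) :
    ‖L.compContinuousMultilinearMap P‖ ≤ ‖P‖ := by
  have h := L.norm_compContinuousMultilinearMap_le P
  have h' : ‖L‖ * ‖P‖ ≤ ‖P‖ := mul_le_of_le_one_left (norm_nonneg P) hL
  exact h.trans h'

/-- Restricting an analytic function to the segments that start at a point gives an analytic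
family of curves. -/
theorem HasFPowerSeriesOnBall.exists_analytic_segment_curve [CompleteSpace G] {f : E → G}
    {P : FormalMultilinearSeries ℝ E G} {p : E} {r : ENNReal}
    (hf : HasFPowerSeriesOnBall f P p r) :
    ∃ c : E → UnitCurve G, AnalyticOnNhd ℝ c (eball 0 r) ∧
      ∀ y ∈ eball (0 : E) r, ∀ t : I, c y t = f (p + (t : ℝ) • y) := by
  -- Since `f (p + t y) = ∑ tᵐ Pₘ(y, …, y)`, the curve is itself a power series in `y`, with
  -- coefficients `tᵐ Pₘ` in the space of curves. Their norms do not exceed those of `Pₘ` because `t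
  -- ≤ 1`.
  let Q : FormalMultilinearSeries ℝ E (UnitCurve G) := fun m =>
    (monomial m).compContinuousMultilinearMap (P m)
  have hQP : ∀ m, ‖Q m‖ ≤ ‖P m‖ := fun m =>
    norm_compContinuousMultilinearMap_le_of_norm_le_one (norm_monomial_le m) (P m)
  have hPQ : P.radius ≤ Q.radius := FormalMultilinearSeries.radius_le_of_le hQP
  have hQ : r ≤ Q.radius := hf.r_le.trans hPQ
  have hsum := Q.hasFPowerSeriesOnBall (hf.r_pos.trans_le hQ)
  have hana : AnalyticOnNhd ℝ Q.sum (eball 0 r) :=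
    hsum.analyticOnNhd.mono (eball_subset_eball hQ)
  refine ⟨Q.sum, hana, fun y hy t => ?_⟩
  have h0 : HasSum (fun m => Q m fun _ => y) (Q.sum y) := Q.hasSum (eball_subset_eball hQ hy)
  have h1 : HasSum (fun m => eval t (Q m fun _ => y)) (eval t (Q.sum y)) := h0.mapL (eval t)
  have hty : (t : ℝ) • y ∈ eball (0 : E) r := by
    rw [mem_eball_zero_iff] at hy ⊢
    refine lt_of_le_of_lt ?_ hy
    have ht : ‖(t : ℝ)‖ₑ ≤ 1 := by
      rw [Real.enorm_of_nonneg t.2.1]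
      exact ENNReal.ofReal_le_one.2 t.2.2
    calc ‖(t : ℝ) • y‖ₑ = ‖(t : ℝ)‖ₑ * ‖y‖ₑ := enorm_smul _ _
      _ ≤ 1 * ‖y‖ₑ := by gcongr
      _ = ‖y‖ₑ := one_mul _
  have h2 := hf.hasSum hty
  refine h1.unique ?_
  convert h2 using 2 with m
  rw [ContinuousMultilinearMap.map_smul_univ (P m) (fun _ => (t : ℝ)) (fun _ => y)]
  simp only [Finset.prod_const, Finset.card_univ, Fintype.card_fin]
  rfl

/-- Re-expanding the power series at `p` costs only `‖p - q‖` of its radius, so one ball around `q`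
serves every starting point `p` in it. -/
theorem AnalyticAt.exists_contDiffOn_segment_curve [CompleteSpace G] {f : E → G} {q : E}
    (hf : AnalyticAt ℝ f q) :
    ∃ r > 0, ∀ p ∈ ball q r, ∃ c : E → UnitCurve G, ContDiffOn ℝ ω c (ball q r) ∧
      ∀ x ∈ ball q r, ∀ t : I, c x t = f (p + (t : ℝ) • (x - p)) := by
  obtain ⟨P, R, hP⟩ := hf
  obtain ⟨ρ, hρ0, hρR⟩ := ENNReal.lt_iff_exists_nnreal_btwn.1 hP.r_pos
  have hρ0 : 0 < (ρ : ℝ) := by exact_mod_cast hρ0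
  -- For `p` and `x` within `ρ / 3` of `q`, `‖x - p‖ + ‖p - q‖ < ρ < R`, so `x - p` lies in the disc
  -- of convergence around `p`.
  refine ⟨ρ / 3, by positivity, fun p hp => ?_⟩
  have hpq : ‖p - q‖ < ρ / 3 := by rwa [mem_ball, dist_eq_norm] at hp
  have hlt : (‖p - q‖₊ : ENNReal) < R := by
    refine lt_trans ?_ hρR
    rw [ENNReal.coe_lt_coe, ← NNReal.coe_lt_coe, coe_nnnorm]
    linarith
  have hc := hP.changeOrigin hlt
  rw [add_sub_cancel] at hc
  obtain ⟨c, hc1, hc2⟩ := hc.exists_analytic_segment_curve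
  have hmaps : ∀ x ∈ ball q (ρ / 3 : ℝ), x - p ∈ eball (0 : E) (R - ‖p - q‖₊) := by
    intro x hx
    have hxq : ‖x - q‖ < ρ / 3 := by rwa [mem_ball, dist_eq_norm] at hx
    have : ‖x - p‖ ≤ ‖x - q‖ + ‖p - q‖ := by
      rw [norm_sub_rev p q]; exact norm_sub_le_norm_sub_add_norm_sub _ _ _
    rw [mem_eball_zero_iff, lt_tsub_iff_right]
    refine lt_trans ?_ hρR
    change ((‖x - p‖₊ + ‖p - q‖₊ : NNReal) : ENNReal) < ρ
    rw [ENNReal.coe_lt_coe, ← NNReal.coe_lt_coe, NNReal.coe_add, coe_nnnorm, coe_nnnorm]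
    linarith
  refine ⟨fun x => c (x - p), ?_, fun x hx t => hc2 _ (hmaps x hx) t⟩
  intro x hx
  have h1 : ContDiffAt ℝ ω c (x - p) := (hc1 _ (hmaps x hx)).contDiffAt
  exact (h1.comp x (contDiffAt_id.sub contDiffAt_const)).contDiffWithinAt

theorem ContDiffAt.clm_apply₂ (K : H →L[ℝ] G →L[ℝ] F) {a : E → H} {w : E → G} {x : E}
    (ha : ContDiffAt ℝ ω a x) (hw : ContDiffAt ℝ ω w x) :
    ContDiffAt ℝ ω (fun x => K (a x) (w x)) x :=
  (K.contDiff.contDiffAt.comp x ha).clm_apply hw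

theorem ContinuousLinearMap.isUnit_one_sub_of_norm_lt_one [CompleteSpace G] {T : G →L[ℝ] G}
    (hT : ‖T‖ < 1) : IsUnit (1 - T) :=
  _root_.isUnit_one_sub_of_norm_lt_one hT

/-- Inversion in a Banach algebra is analytic at units, and `1 - K (a x)` is a unit by the Neumann
series. -/
theorem ContDiffAt.ringInverse_one_sub_apply [CompleteSpace G] (K : H →L[ℝ] G →L[ℝ] G)
    (L : G →L[ℝ] F) {a : E → H} {w : E → G} {x : E}
    (ha : ContDiffAt ℝ ω a x) (hw : ContDiffAt ℝ ω w x) (hx : ‖K (a x)‖ < 1) :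
    ContDiffAt ℝ ω (fun x => L (Ring.inverse (1 - K (a x)) (w x))) x := by
  have h1 : ContDiffAt ℝ ω (fun x => 1 - K (a x)) x :=
    contDiffAt_const.sub (K.contDiff.contDiffAt.comp x ha)
  have h2 : ContDiffAt ℝ ω (fun x => Ring.inverse (1 - K (a x))) x := by
    obtain ⟨u, hu⟩ := ContinuousLinearMap.isUnit_one_sub_of_norm_lt_one hx
    have := contDiffAt_ringInverse ℝ (n := ω) u
    rw [hu] at this
    exact this.comp x h1
  exact L.contDiff.contDiffAt.comp x (h2.clm_apply hw)

/-- The solution at time `1` of the linear initial value problem `u' = B A u + b`, `u 0 = y₀`. -/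
noncomputable def linearFlow (B : H →L[ℝ] F →L[ℝ] F) (y₀ : F) (A : UnitCurve H)
    (b : UnitCurve F) : F :=
  -- The integrated problem is `(1 - volterra B A) u = y₀ + ∫ b`. `Ring.inverse` is `0` off the
  -- units, so the formula has its meaning only when `1 - volterra B A` is invertible.
  eval 1 (Ring.inverse (1 - volterra B A) (monomial 0 y₀ + primitive b))

theorem contDiffAt_linearFlow [CompleteSpace F] {B : H →L[ℝ] F →L[ℝ] F} {A : E → UnitCurve H}
    {b : E → UnitCurve F} {x : E} (y₀ : F) (hA : ContDiffAt ℝ ω A x) (hb : ContDiffAt ℝ ω b x)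
    (hx : ‖volterra B (A x)‖ < 1) :
    ContDiffAt ℝ ω (fun x => linearFlow B y₀ (A x) (b x)) x :=
  ContDiffAt.ringInverse_one_sub_apply (volterra B) (eval 1) hA
    (contDiffAt_const.add (primitive.contDiff.contDiffAt.comp x hb)) hx

/-- The fundamental theorem of calculus turns the ODE into the Volterra equation, whose operator `1
- volterra B A` is invertible. -/
theorem eq_linearFlow_of_hasDerivAt [CompleteSpace F] {B : H →L[ℝ] F →L[ℝ] F} {A : UnitCurve H}
    {b : UnitCurve F} (hA : ‖volterra B A‖ < 1) {w : ℝ → F}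
    (hw : ∀ t : I, HasDerivAt w (B (A t) (w t) + b t) t) : w 1 = linearFlow B (w 0) A b := by
  have hwc : Continuous fun t : I => w t :=
    continuous_iff_continuousAt.2 fun t =>
      (hw t).continuousAt.comp continuous_subtype_val.continuousAt
  let u : UnitCurve F := UnitCurve.mk (fun t => w t) hwc
  have hprim : primitive (bilinear B A u + b) = u - monomial 0 (w 0) := by
    ext t
    rw [primitive_apply]
    have hderiv : ∀ s ∈ uIcc (0 : ℝ) t,
        HasDerivAt w (IccExtend zero_le_one (bilinear B A u + b) s) s := by
      intro s hs
      rw [uIcc_of_le t.2.1] at hs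
      have hs' : s ∈ I := ⟨hs.1, hs.2.trans t.2.2⟩
      rw [IccExtend_of_mem _ _ hs']
      exact hw ⟨s, hs'⟩
    rw [intervalIntegral.integral_eq_sub_of_hasDerivAt hderiv
      ((bilinear B A u + b).continuous_iccExtend.intervalIntegrable _ _)]
    simp [u]
  have hu : (1 - volterra B A) u = monomial 0 (w 0) + primitive b := by
    rw [map_add, ← volterra_apply, ← eq_sub_iff_add_eq'] at hprim
    rw [hprim, _root_.sub_apply, one_apply_eq_self]
    abel
  rw [linearFlow, ← hu]
  have := Ring.inverse_mul_cancel (1 - volterra B A)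
    (ContinuousLinearMap.isUnit_one_sub_of_norm_lt_one hA)
  have := congrArg (fun T : UnitCurve F →L[ℝ] UnitCurve F => T u 1) this
  exact this.symm

/-- Solutions of a closed linear first order system `D y = Θ y + β` with analytic coefficients
continue analytically to a ball that does not depend on the initial data. -/
theorem exists_analytic_continuation_of_closed_system_aux [CompleteSpace F] [CompleteSpace G]
    [CompleteSpace H] {H' : Type*} [NormedAddCommGroup H'] [NormedSpace ℝ H']
    (S : H →L[ℝ] E →L[ℝ] H') (S' : H' →L[ℝ] F →L[ℝ] F) (T : G →L[ℝ] E →L[ℝ] F)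
    {Θ : E → H} {β : E → G} {q : E} (hΘ : AnalyticAt ℝ Θ q) (hβ : AnalyticAt ℝ β q) :
    ∃ r > 0, ∀ p ∈ ball q r, ∀ y₀ : F, ∃ z : E → F, ContDiffOn ℝ ω z (ball q r) ∧
      ∀ C ⊆ ball q r, Convex ℝ C → p ∈ C → ∀ y : E → F,
        (∀ x ∈ C, DifferentiableAt ℝ y x) →
        (∀ x ∈ C, ∀ v, fderiv ℝ y x v = S' (S (Θ x) v) (y x) + T (β x) v) →
        y p = y₀ → EqOn y z C := by
  obtain ⟨r₁, hr₁, h₁⟩ := hΘ.exists_contDiffOn_segment_curve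
  obtain ⟨r₂, hr₂, h₂⟩ := hβ.exists_contDiffOn_segment_curve
  obtain ⟨r₃, hr₃, h₃⟩ := Metric.eventually_nhds_iff_ball.1
    (hΘ.continuousAt.norm.eventually_lt_const (lt_add_one ‖Θ q‖))
  -- Points of `ball q r` are at distance at most `2 r`, and `‖Θ‖ < ‖Θ q‖ + 1` there, so the
  -- Volterra operator has norm at most `(B - 1) * (2 * r) ≤ 1 / 2` once `r ≤ 1 / (4 * B)`. The
  -- final `+ 1` keeps `B` positive.
  set B := ‖S'‖ * (‖S‖ * (‖Θ q‖ + 1)) + 1 with hB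
  have hB0 : 0 < B := by positivity
  set r := min (min r₁ r₂) (min r₃ (1 / (4 * B))) with hr
  have hr0 : 0 < r := by positivity
  have hr1 : r ≤ r₁ := (min_le_left _ _).trans (min_le_left _ _)
  have hr2 : r ≤ r₂ := (min_le_left _ _).trans (min_le_right _ _)
  have hr3 : r ≤ r₃ := (min_le_right _ _).trans (min_le_left _ _)
  have hr4 : r ≤ 1 / (4 * B) := (min_le_right _ _).trans (min_le_right _ _)
  refine ⟨r, hr0, fun p hp y₀ => ?_⟩
  obtain ⟨c₁, hc₁, hc₁'⟩ := h₁ p (ball_subset_ball hr1 hp)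
  obtain ⟨c₂, hc₂, hc₂'⟩ := h₂ p (ball_subset_ball hr2 hp)
  -- `A x` and `b x` are the coefficients of the ODE that `t ↦ y (p + t (x - p))` satisfies; the
  -- chain rule contributes the factor `x - p`, entered as a constant curve.
  let A : E → UnitCurve H' := fun x => bilinear S (c₁ x) (monomial 0 (x - p))
  let b : E → UnitCurve F := fun x => bilinear T (c₂ x) (monomial 0 (x - p))
  have hAt : ∀ x ∈ ball q r, ∀ t : I, A x t = S (Θ (p + (t : ℝ) • (x - p))) (x - p) := by
    intro x hx t
    simp only [A, bilinear_apply, monomial_zero_apply]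
    rw [hc₁' x (ball_subset_ball hr1 hx)]
  have hbt : ∀ x ∈ ball q r, ∀ t : I, b x t = T (β (p + (t : ℝ) • (x - p))) (x - p) := by
    intro x hx t
    simp only [b, bilinear_apply, monomial_zero_apply]
    rw [hc₂' x (ball_subset_ball hr2 hx)]
  have hseg : ∀ {C : Set E}, Convex ℝ C → p ∈ C → ∀ x ∈ C, ∀ t : I,
      p + (t : ℝ) • (x - p) ∈ C := fun hC hp x hx t => hC.add_smul_sub_mem hp hx t.2
  have hAnorm : ∀ x ∈ ball q r, ‖volterra S' (A x)‖ < 1 := by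
    intro x hx
    have hxp : ‖x - p‖ ≤ 2 * r := by
      rw [← dist_eq_norm]
      have := dist_triangle_right x p q
      rw [mem_ball] at hx hp
      linarith
    have : ‖volterra S' (A x)‖ ≤ ‖S'‖ * (‖S‖ * (‖Θ q‖ + 1) * (2 * r)) := by
      refine norm_volterra_le (by positivity) fun t => (S'.le_opNorm _).trans ?_
      gcongr
      rw [hAt x hx]
      refine (S.le_opNorm₂ _ _).trans ?_
      gcongr
      exact (h₃ _ (ball_subset_ball hr3 (hseg (convex_ball q r) hp x hx t))).le
    calc ‖volterra S' (A x)‖ ≤ (B - 1) * (2 * r) := this.trans_eq (by rw [hB]; ring)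
      _ ≤ B * (2 * (1 / (4 * B))) := by gcongr; linarith
      _ = 1 / 2 := by field_simp; norm_num
      _ < 1 := by norm_num
  have hmono : ContDiff ℝ ω fun x : E => (monomial 0 (x - p) : UnitCurve E) :=
    (monomial (G := E) 0).contDiff.comp (contDiff_id.sub contDiff_const)
  -- The value at the end of the segment from `p` to `x`. It uses only `y₀`, so it exists on the
  -- whole ball even if no solution of the system does.
  refine ⟨fun x => linearFlow S' y₀ (A x) (b x), ?_, ?_⟩
  · intro x hx
    have hA : ContDiffAt ℝ ω A x :=
      ContDiffAt.clm_apply₂ (bilinear S)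
        (hc₁.contDiffAt (isOpen_ball.mem_nhds (ball_subset_ball hr1 hx))) hmono.contDiffAt
    have hb : ContDiffAt ℝ ω b x :=
      ContDiffAt.clm_apply₂ (bilinear T)
        (hc₂.contDiffAt (isOpen_ball.mem_nhds (ball_subset_ball hr2 hx))) hmono.contDiffAt
    exact (contDiffAt_linearFlow y₀ hA hb (hAnorm x hx)).contDiffWithinAt
  · intro C hCr hC hpC y hyd hy hyp x hx
    have := eq_linearFlow_of_hasDerivAt (B := S') (A := A x) (b := b x) (hAnorm x (hCr hx))
      (w := fun t => y (p + t • (x - p))) (fun t => by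
        have hmem := hseg hC hpC x hx t
        rw [hAt x (hCr hx), hbt x (hCr hx), ← hy _ hmem]
        have h1 : HasDerivAt (fun t : ℝ => p + t • (x - p)) (x - p) (t : ℝ) := by
          simpa using ((hasDerivAt_id (t : ℝ)).smul_const (x - p)).const_add p
        exact (hyd _ hmem).hasFDerivAt.comp_hasDerivAt (t : ℝ) h1)
    simpa [hyp] using this

/-- The abstract pairings `S`, `S'`, `T` become the evaluation of continuous linear maps. -/
theorem exists_analytic_continuation_of_closed_system [CompleteSpace F]
    {Θ : E → E →L[ℝ] F →L[ℝ] F} {β : E → E →L[ℝ] F} {q : E}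
    (hΘ : AnalyticAt ℝ Θ q) (hβ : AnalyticAt ℝ β q) :
    ∃ r > 0, ∀ p ∈ ball q r, ∀ y₀ : F, ∃ z : E → F, ContDiffOn ℝ ω z (ball q r) ∧
      ∀ C ⊆ ball q r, Convex ℝ C → p ∈ C → ∀ y : E → F,
        (∀ x ∈ C, DifferentiableAt ℝ y x) →
        (∀ x ∈ C, ∀ v, fderiv ℝ y x v = Θ x v (y x) + β x v) → y p = y₀ → EqOn y z C :=
  exists_analytic_continuation_of_closed_system_aux (.id ℝ _) (.id ℝ _) (.id ℝ _) hΘ hβ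

end LinearODE

/-! ### The equation in coordinates and its prolongation to a closed system for `(X, DX)` -/

section Flat

set_option maxSynthPendingDepth 3

open Set Filter

open Metric

/-- The combination of the values of a trilinear form by which Koszul's formula solves
`B(V; Y, Z) + B(V; Z, Y) = S(V; Y, Z)` for a form `B` symmetric in its first two arguments. -/
noncomputable def koszul {E : Type*} (S : E → E → E → ℝ) (V Y Z : E) : ℝ :=
  (S V Y Z + S Y Z V - S Z V Y) / 2

/-- In the cyclic sum the symmetry of `B` cancels four of the six terms and leaves `2 B(V; Y, Z)`,
as in the construction of the Levi-Civita connection. -/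
theorem koszul_eq {E : Type*} {B S : E → E → E → ℝ} (hB : ∀ V Y Z, B V Y Z = B Y V Z)
    (h : ∀ V Y Z, B V Y Z + B V Z Y = S V Y Z) (V Y Z : E) : koszul S V Y Z = B V Y Z := by
  rw [koszul, ← h, ← h, ← h, hB Y Z V, hB Y V Z, hB Z V Y]
  ring

variable {E : Type*} [NormedAddCommGroup E] [NormedSpace ℝ E]

/-- The equation `L_X T = h` in coordinates, tested on constant vector fields. -/
def FlatLieDerivEqOn (T h : E → E →L[ℝ] E →L[ℝ] ℝ) (X : E → E) (s : Set E) : Prop :=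
  ∀ x ∈ s, ∀ v w, fderiv ℝ T x (X x) v w + T x (fderiv ℝ X x v) w + T x v (fderiv ℝ X x w)
    = h x v w

theorem FlatLieDerivEqOn.mono {T h : E → E →L[ℝ] E →L[ℝ] ℝ} {X : E → E} {s t : Set E}
    (hX : FlatLieDerivEqOn T h X s) (hts : t ⊆ s) : FlatLieDerivEqOn T h X t :=
  fun x hx => hX x (hts hx)

theorem FlatLieDerivEqOn.congr {T h : E → E →L[ℝ] E →L[ℝ] ℝ} {X Y : E → E} {s : Set E}
    (hX : FlatLieDerivEqOn T h X s) (hs : IsOpen s) (hXY : EqOn Y X s) :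
    FlatLieDerivEqOn T h Y s := by
  intro x hx v w
  have h1 : Y =ᶠ[𝓝 x] X := hXY.eventuallyEq_of_mem (hs.mem_nhds hx)
  rw [h1.fderiv_eq, hXY hx]
  exact hX x hx v w

/-- A linear map on a finite-dimensional space as a continuous linear map. -/
noncomputable def IsLinearMap.toCLM {V W : Type*} [NormedAddCommGroup V] [NormedSpace ℝ V]
    [FiniteDimensional ℝ V] [NormedAddCommGroup W] [NormedSpace ℝ W] {f : V → W}
    (hf : IsLinearMap ℝ f) : V →L[ℝ] W :=
  LinearMap.toContinuousLinearMap (hf.mk' f)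

@[simp] theorem IsLinearMap.toCLM_apply {V W : Type*} [NormedAddCommGroup V] [NormedSpace ℝ V]
    [FiniteDimensional ℝ V] [NormedAddCommGroup W] [NormedSpace ℝ W] {f : V → W}
    (hf : IsLinearMap ℝ f) (v : V) : hf.toCLM v = f v := rfl

theorem contDiffOn_toCLM {V W D : Type*} [NormedAddCommGroup V] [NormedSpace ℝ V]
    [FiniteDimensional ℝ V] [NormedAddCommGroup W] [NormedSpace ℝ W] [NormedAddCommGroup D]
    [NormedSpace ℝ D] {f : D → V → W} (hf : ∀ x, IsLinearMap ℝ (f x)) {s : Set D} {n : ℕ∞ω}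
    (h : ∀ v, ContDiffOn ℝ n (fun x => f x v) s) : ContDiffOn ℝ n (fun x => (hf x).toCLM) s :=
  contDiffOn_clm_apply.2 h

/-- The terms of the derivative of `L_X T` of order at most one in `X`. -/
noncomputable def lowerOrder (T₁ : E →L[ℝ] E →L[ℝ] E →L[ℝ] ℝ)
    (T₂ : E →L[ℝ] E →L[ℝ] E →L[ℝ] E →L[ℝ] ℝ) (y : E × (E →L[ℝ] E)) (V Y Z : E) : ℝ :=
  -(T₂ V y.1 Y Z + T₁ (y.2 V) Y Z + T₁ V (y.2 Y) Z + T₁ V Y (y.2 Z))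

/-- `koszul S` is linear in each argument if `S` is. -/
structure IsTrilinear (S : E → E → E → ℝ) : Prop where
  fst : ∀ Y Z, IsLinearMap ℝ fun V => S V Y Z
  snd : ∀ V Z, IsLinearMap ℝ fun Y => S V Y Z
  trd : ∀ V Y, IsLinearMap ℝ fun Z => S V Y Z

theorem IsTrilinear.koszul {S : E → E → E → ℝ} (h : IsTrilinear S) : IsTrilinear (koszul S) where
  fst Y Z := by
    constructor <;> intros <;>
      simp only [_root_.koszul, (h.fst _ _).map_add, (h.snd _ _).map_add, (h.trd _ _).map_add,
        (h.fst _ _).map_smul, (h.snd _ _).map_smul, (h.trd _ _).map_smul, smul_eq_mul] <;> ring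
  snd Y Z := by
    constructor <;> intros <;>
      simp only [_root_.koszul, (h.fst _ _).map_add, (h.snd _ _).map_add, (h.trd _ _).map_add,
        (h.fst _ _).map_smul, (h.snd _ _).map_smul, (h.trd _ _).map_smul, smul_eq_mul] <;> ring
  trd Y Z := by
    constructor <;> intros <;>
      simp only [_root_.koszul, (h.fst _ _).map_add, (h.snd _ _).map_add, (h.trd _ _).map_add,
        (h.fst _ _).map_smul, (h.snd _ _).map_smul, (h.trd _ _).map_smul, smul_eq_mul] <;> ring

theorem isTrilinear_coe (T₁ : E →L[ℝ] E →L[ℝ] E →L[ℝ] ℝ) :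
    IsTrilinear fun V Y Z => T₁ V Y Z where
  fst Y Z := by constructor <;> intros <;> simp
  snd V Z := by constructor <;> intros <;> simp
  trd V Y := by constructor <;> intros <;> simp

theorem isTrilinear_lowerOrder (T₁ : E →L[ℝ] E →L[ℝ] E →L[ℝ] ℝ)
    (T₂ : E →L[ℝ] E →L[ℝ] E →L[ℝ] E →L[ℝ] ℝ) (y : E × (E →L[ℝ] E)) :
    IsTrilinear (lowerOrder T₁ T₂ y) where
  fst Y Z := by constructor <;> intros <;> simp [lowerOrder] <;> ring
  snd V Z := by constructor <;> intros <;> simp [lowerOrder] <;> ring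
  trd V Y := by constructor <;> intros <;> simp [lowerOrder] <;> ring

theorem isLinearMap_koszul_lowerOrder (T₁ : E →L[ℝ] E →L[ℝ] E →L[ℝ] ℝ)
    (T₂ : E →L[ℝ] E →L[ℝ] E →L[ℝ] E →L[ℝ] ℝ) (V Y Z : E) :
    IsLinearMap ℝ fun y => koszul (lowerOrder T₁ T₂ y) V Y Z := by
  constructor <;> intros <;> simp [koszul, lowerOrder] <;> ring

theorem hasFDerivAt_bilinear_apply {B : E → E →L[ℝ] E →L[ℝ] ℝ} {B' : E →L[ℝ] E →L[ℝ] E →L[ℝ] ℝ}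
    {u w : E → E} {u' w' : E →L[ℝ] E} {x : E} (hB : HasFDerivAt B B' x) (hu : HasFDerivAt u u' x)
    (hw : HasFDerivAt w w' x) :
    ∃ D : E →L[ℝ] ℝ, HasFDerivAt (fun x => B x (u x) (w x)) D x ∧
      ∀ V, D V = B' V (u x) (w x) + B x (u' V) (w x) + B x (u x) (w' V) := by
  refine ⟨_, (hB.clm_apply hu).clm_apply hw, fun V => ?_⟩
  simp
  ring

/-- The derivative of the equation `L_X T = h`. -/
theorem FlatLieDerivEqOn.fderiv_eq {T h : E → E →L[ℝ] E →L[ℝ] ℝ} {X : E → E} {s : Set E}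
    (hs : IsOpen s) (hT : ContDiffOn ℝ ω T s) (hh : ContDiffOn ℝ ω h s)
    (hX : ContDiffOn ℝ 2 X s) (heq : FlatLieDerivEqOn T h X s) {x : E} (hx : x ∈ s)
    (V Y Z : E) :
    T x (fderiv ℝ (fderiv ℝ X) x V Y) Z + T x Y (fderiv ℝ (fderiv ℝ X) x V Z) =
      fderiv ℝ h x V Y Z
        + lowerOrder (fderiv ℝ T x) (fderiv ℝ (fderiv ℝ T) x) (X x, fderiv ℝ X x) V Y Z := by
  have hmem := hs.mem_nhds hx
  have hT0 : HasFDerivAt T (fderiv ℝ T x) x :=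
    ((hT.contDiffAt hmem).differentiableAt (by simp)).hasFDerivAt
  have hT1 : HasFDerivAt (fderiv ℝ T) (fderiv ℝ (fderiv ℝ T) x) x :=
    (((hT.contDiffAt hmem).fderiv_right (m := ω) le_rfl).differentiableAt (by simp)).hasFDerivAt
  have hh0 : HasFDerivAt h (fderiv ℝ h x) x :=
    ((hh.contDiffAt hmem).differentiableAt (by simp)).hasFDerivAt
  have hX0 : HasFDerivAt X (fderiv ℝ X x) x :=
    ((hX.contDiffAt hmem).differentiableAt (by simp)).hasFDerivAt
  have hX1 : HasFDerivAt (fderiv ℝ X) (fderiv ℝ (fderiv ℝ X) x) x :=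
    (((hX.contDiffAt hmem).fderiv_right (m := 1) (by norm_num)).differentiableAt
      (by simp)).hasFDerivAt
  have hXv : ∀ v, HasFDerivAt (fun x => fderiv ℝ X x v)
      ((fderiv ℝ (fderiv ℝ X) x).flip v) x := fun v => by
    simpa using hX1.clm_apply (hasFDerivAt_const v x)
  obtain ⟨D₁, hD₁, hD₁'⟩ := hasFDerivAt_bilinear_apply (hT1.clm_apply hX0)
    (hasFDerivAt_const Y x) (hasFDerivAt_const Z x)
  obtain ⟨D₂, hD₂, hD₂'⟩ := hasFDerivAt_bilinear_apply hT0 (hXv Y) (hasFDerivAt_const Z x)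
  obtain ⟨D₃, hD₃, hD₃'⟩ := hasFDerivAt_bilinear_apply hT0 (hasFDerivAt_const Y x) (hXv Z)
  obtain ⟨D₄, hD₄, hD₄'⟩ := hasFDerivAt_bilinear_apply hh0 (hasFDerivAt_const Y x)
    (hasFDerivAt_const Z x)
  have hev : (fun x => h x Y Z) =ᶠ[𝓝 x] fun x => fderiv ℝ T x (X x) Y Z
      + T x (fderiv ℝ X x Y) Z + T x Y (fderiv ℝ X x Z) := by
    filter_upwards [hmem] with x' hx'
    exact (heq x' hx' Y Z).symm
  -- Both sides of the equation are differentiated with `Y` and `Z` held constant; uniqueness of the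
  -- derivative equates the results.
  have hD := (((hD₁.add hD₂).add hD₃).congr_of_eventuallyEq hev).unique hD₄
  have hDV := congrArg (fun D : E →L[ℝ] ℝ => D V) hD
  simp only [_root_.add_apply, hD₁', hD₂', hD₃', hD₄'] at hDV
  simp only [ContinuousLinearMap.comp_apply, ContinuousLinearMap.flip_apply,
    _root_.zero_apply, map_zero, add_zero] at hDV
  rw [← hDV, lowerOrder]
  ring

variable [FiniteDimensional ℝ E]

/-- Raising the last index of a trilinear form with `g`. -/
noncomputable def raise (g : E →L[ℝ] E →L[ℝ] ℝ) {S : E → E → E → ℝ} (hS : IsTrilinear S)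
    (V : E) : E →L[ℝ] E :=
  IsLinearMap.toCLM (f := fun Y => g.inverse (hS.trd V Y).toCLM) (by
    constructor
    · intro Y Y'
      rw [← map_add]
      congr 1
      ext Z
      exact (hS.snd V Z).map_add Y Y'
    · intro c Y
      rw [← map_smul]
      congr 1
      ext Z
      exact (hS.snd V Z).map_smul c Y)

theorem raise_apply (g : E →L[ℝ] E →L[ℝ] ℝ) {S : E → E → E → ℝ} (hS : IsTrilinear S)
    (V Y : E) : raise g hS V Y = g.inverse (hS.trd V Y).toCLM := rfl

theorem isLinearMap_raise (g : E →L[ℝ] E →L[ℝ] ℝ) {S : E → E → E → ℝ} (hS : IsTrilinear S) :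
    IsLinearMap ℝ (raise g hS) := by
  constructor
  · intro V V'
    ext Y
    rw [_root_.add_apply, raise_apply, raise_apply, raise_apply, ← map_add]
    congr 1
    ext Z
    exact (hS.fst Y Z).map_add V V'
  · intro c V
    ext Y
    rw [_root_.smul_apply, raise_apply, raise_apply, ← map_smul]
    congr 1
    ext Z
    exact (hS.fst Y Z).map_smul c V

/-- Inversion of continuous linear maps is analytic at invertible ones; the remaining dependence is
checked on components. -/
theorem contDiffOn_raise {D : Type*} [NormedAddCommGroup D] [NormedSpace ℝ D]
    {g : D → E →L[ℝ] E →L[ℝ] ℝ} {S : D → E → E → E → ℝ} (hS : ∀ x, IsTrilinear (S x))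
    {s : Set D} {n : ℕ∞ω} (hg : ContDiffOn ℝ n g s) (hinv : ∀ x ∈ s, (g x).IsInvertible)
    (h : ∀ V Y Z, ContDiffOn ℝ n (fun x => S x V Y Z) s) (V : E) :
    ContDiffOn ℝ n (fun x => raise (g x) (hS x) V) s := by
  refine contDiffOn_toCLM _ fun Y => ?_
  have h1 : ContDiffOn ℝ n (fun x => (g x).inverse) s := fun x hx =>
    (hinv x hx).contDiffAt_map_inverse.comp_contDiffWithinAt x (hg x hx)
  exact h1.clm_apply (contDiffOn_toCLM _ fun Z => h V Y Z)

/-- The linear part of the first order system for `(X, D X)`. -/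
noncomputable def prolongationLinear (g : E →L[ℝ] E →L[ℝ] ℝ) (T₁ : E →L[ℝ] E →L[ℝ] E →L[ℝ] ℝ)
    (T₂ : E →L[ℝ] E →L[ℝ] E →L[ℝ] E →L[ℝ] ℝ) :
    E →L[ℝ] (E × (E →L[ℝ] E)) →L[ℝ] (E × (E →L[ℝ] E)) :=
  IsLinearMap.toCLM (f := fun V =>
    IsLinearMap.toCLM
      (f := fun y => (y.2 V, raise g (isTrilinear_lowerOrder T₁ T₂ y).koszul V)) (by
        constructor
        · intro y y'
          refine Prod.ext rfl ?_
          ext Y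
          change g.inverse _ = g.inverse _ + g.inverse _
          rw [← map_add]
          congr 1
          ext Z
          exact (isLinearMap_koszul_lowerOrder T₁ T₂ V Y Z).map_add y y'
        · intro c y
          refine Prod.ext rfl ?_
          ext Y
          change g.inverse _ = c • g.inverse _
          rw [← map_smul]
          congr 1
          ext Z
          exact (isLinearMap_koszul_lowerOrder T₁ T₂ V Y Z).map_smul c y)) (by
    constructor
    · intro V V'
      refine ContinuousLinearMap.ext fun y => ?_
      exact Prod.ext (map_add y.2 V V')
        ((isLinearMap_raise g (isTrilinear_lowerOrder T₁ T₂ y).koszul).map_add V V')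
    · intro c V
      refine ContinuousLinearMap.ext fun y => ?_
      exact Prod.ext (map_smul y.2 c V)
        ((isLinearMap_raise g (isTrilinear_lowerOrder T₁ T₂ y).koszul).map_smul c V))

theorem prolongationLinear_apply (g : E →L[ℝ] E →L[ℝ] ℝ) (T₁ : E →L[ℝ] E →L[ℝ] E →L[ℝ] ℝ)
    (T₂ : E →L[ℝ] E →L[ℝ] E →L[ℝ] E →L[ℝ] ℝ) (V : E) (y : E × (E →L[ℝ] E)) :
    prolongationLinear g T₁ T₂ V y =
      (y.2 V, raise g (isTrilinear_lowerOrder T₁ T₂ y).koszul V) := rfl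

/-- The inhomogeneous part of the first order system for `(X, D X)`. -/
noncomputable def prolongationConst (g : E →L[ℝ] E →L[ℝ] ℝ) (h₁ : E →L[ℝ] E →L[ℝ] E →L[ℝ] ℝ) :
    E →L[ℝ] (E × (E →L[ℝ] E)) :=
  IsLinearMap.toCLM (f := fun V => ((0 : E), raise g (isTrilinear_coe h₁).koszul V)) (by
    constructor
    · intro V V'
      exact Prod.ext (add_zero 0).symm
        ((isLinearMap_raise g (isTrilinear_coe h₁).koszul).map_add V V')
    · intro c V
      exact Prod.ext (smul_zero c).symm
        ((isLinearMap_raise g (isTrilinear_coe h₁).koszul).map_smul c V))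

theorem prolongationConst_apply (g : E →L[ℝ] E →L[ℝ] ℝ) (h₁ : E →L[ℝ] E →L[ℝ] E →L[ℝ] ℝ) (V : E) :
    prolongationConst g h₁ V = (0, raise g (isTrilinear_coe h₁).koszul V) := rfl

theorem contDiffOn_prolongationLinear {g : E → E →L[ℝ] E →L[ℝ] ℝ} {s : Set E} (hs : IsOpen s)
    (hg : ContDiffOn ℝ ω g s) (hinv : ∀ x ∈ s, (g x).IsInvertible) :
    ContDiffOn ℝ ω
      (fun x => prolongationLinear (g x) (fderiv ℝ g x) (fderiv ℝ (fderiv ℝ g) x)) s := by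
  have h1 : ContDiffOn ℝ ω (fderiv ℝ g) s := hg.fderiv_of_isOpen hs le_rfl
  have h2 : ContDiffOn ℝ ω (fderiv ℝ (fderiv ℝ g)) s := h1.fderiv_of_isOpen hs le_rfl
  have h1' : ∀ V Y Z, ContDiffOn ℝ ω (fun x => fderiv ℝ g x V Y Z) s := fun V Y Z =>
    ((h1.clm_apply contDiffOn_const).clm_apply contDiffOn_const).clm_apply contDiffOn_const
  have h2' : ∀ U V Y Z, ContDiffOn ℝ ω (fun x => fderiv ℝ (fderiv ℝ g) x U V Y Z) s :=
    fun U V Y Z => (((h2.clm_apply contDiffOn_const).clm_apply contDiffOn_const).clm_apply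
      contDiffOn_const).clm_apply contDiffOn_const
  have h3 : ∀ y V Y Z, ContDiffOn ℝ ω
      (fun x => lowerOrder (fderiv ℝ g x) (fderiv ℝ (fderiv ℝ g) x) y V Y Z) s :=
    fun y V Y Z => ((((h2' _ _ _ _).add (h1' _ _ _)).add (h1' _ _ _)).add (h1' _ _ _)).neg
  refine contDiffOn_toCLM _ fun V => contDiffOn_toCLM _ fun y => contDiffOn_const.prodMk ?_
  exact contDiffOn_raise _ hg hinv
    (fun V Y Z => (((h3 y V Y Z).add (h3 y Y Z V)).sub (h3 y Z V Y)).div_const 2) V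

theorem contDiffOn_prolongationConst {g h : E → E →L[ℝ] E →L[ℝ] ℝ} {s : Set E} (hs : IsOpen s)
    (hg : ContDiffOn ℝ ω g s) (hh : ContDiffOn ℝ ω h s) (hinv : ∀ x ∈ s, (g x).IsInvertible) :
    ContDiffOn ℝ ω (fun x => prolongationConst (g x) (fderiv ℝ h x)) s := by
  have h1 : ContDiffOn ℝ ω (fderiv ℝ h) s := hh.fderiv_of_isOpen hs le_rfl
  have h1' : ∀ V Y Z, ContDiffOn ℝ ω (fun x => fderiv ℝ h x V Y Z) s := fun V Y Z =>
    ((h1.clm_apply contDiffOn_const).clm_apply contDiffOn_const).clm_apply contDiffOn_const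
  refine contDiffOn_toCLM _ fun V => contDiffOn_const.prodMk ?_
  exact contDiffOn_raise _ hg hinv
    (fun V Y Z => (((h1' V Y Z).add (h1' Y Z V)).sub (h1' Z V Y)).div_const 2) V

/-- Nondegeneracy is injectivity of `E → E*`, and both spaces have the same finite dimension. -/
theorem isInvertible_of_nondegenerate {g : E →L[ℝ] E →L[ℝ] ℝ}
    (h : ∀ v, (∀ w, g v w = 0) → v = 0) : g.IsInvertible := by
  have hinj : Function.Injective (g : E →ₗ[ℝ] E →L[ℝ] ℝ) := by
    rw [injective_iff_map_eq_zero]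
    intro v hv
    refine h v fun w => ?_
    change (g : E →ₗ[ℝ] E →L[ℝ] ℝ) v w = 0
    rw [hv, _root_.zero_apply]
  have hrank : Module.finrank ℝ E = Module.finrank ℝ (E →L[ℝ] ℝ) := by
    rw [← Subspace.dual_finrank_eq (K := ℝ) (V := E)]
    exact (LinearMap.toContinuousLinearMap (𝕜 := ℝ) (E := E) (F' := ℝ)).finrank_eq
  exact ⟨(LinearEquiv.ofInjectiveOfFinrankEq _ hinj hrank).toContinuousLinearEquiv,
    ContinuousLinearMap.ext fun _ => rfl⟩

/-- The pair `(X, D X)` solves a closed first order system if `L_X T = h`. -/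
theorem FlatLieDerivEqOn.prolongation {T h : E → E →L[ℝ] E →L[ℝ] ℝ} {X : E → E} {s : Set E}
    (hs : IsOpen s) (hT : ContDiffOn ℝ ω T s) (hh : ContDiffOn ℝ ω h s)
    (hsymm : ∀ x ∈ s, ∀ v w, T x v w = T x w v) (hinv : ∀ x ∈ s, (T x).IsInvertible)
    (hX : ContDiffOn ℝ 2 X s) (heq : FlatLieDerivEqOn T h X s) {x : E} (hx : x ∈ s) :
    DifferentiableAt ℝ (fun x => (X x, fderiv ℝ X x)) x ∧ ∀ V,
      fderiv ℝ (fun x => (X x, fderiv ℝ X x)) x V =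
        prolongationLinear (T x) (fderiv ℝ T x) (fderiv ℝ (fderiv ℝ T) x) V
          (X x, fderiv ℝ X x) + prolongationConst (T x) (fderiv ℝ h x) V := by
  have hmem := hs.mem_nhds hx
  have hX0 : DifferentiableAt ℝ X x := (hX.contDiffAt hmem).differentiableAt (by simp)
  have hX1 : DifferentiableAt ℝ (fderiv ℝ X) x :=
    ((hX.contDiffAt hmem).fderiv_right (m := 1) (by norm_num)).differentiableAt (by simp)
  refine ⟨hX0.prodMk hX1, fun V => ?_⟩
  have hfd := (hX0.hasFDerivAt.prodMk hX1.hasFDerivAt).fderiv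
  rw [hfd, prolongationLinear_apply, prolongationConst_apply]
  refine Prod.ext (add_zero _).symm ?_
  ext1 Y
  -- Symmetry of the second derivative is the symmetry in the first two arguments that Koszul's
  -- formula requires; this is where class `C^2` enters.
  have hsec : IsSymmSndFDerivAt ℝ X x := (hX.contDiffAt hmem).isSymmSndFDerivAt (by simp)
  change fderiv ℝ (fderiv ℝ X) x V Y =
    raise (T x) (isTrilinear_lowerOrder _ _ (X x, fderiv ℝ X x)).koszul V Y +
      raise (T x) (isTrilinear_coe (fderiv ℝ h x)).koszul V Y
  rw [raise_apply, raise_apply, ← map_add, eq_comm, (hinv x hx).inverse_apply_eq]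
  ext1 Z
  rw [_root_.add_apply, IsLinearMap.toCLM_apply, IsLinearMap.toCLM_apply]
  have key := koszul_eq (B := fun V Y Z => T x (fderiv ℝ (fderiv ℝ X) x V Y) Z)
    (S := fun V Y Z => fderiv ℝ h x V Y Z
        + lowerOrder (fderiv ℝ T x) (fderiv ℝ (fderiv ℝ T) x) (X x, fderiv ℝ X x) V Y Z)
    (fun V Y Z => by rw [hsec.eq V Y])
    (fun V Y Z => by
      rw [← heq.fderiv_eq hs hT hh hX hx V Y Z, hsymm x hx Y]) V Y Z
  rw [← key]
  simp only [koszul]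
  ring

/-- Local extension and uniqueness for the equation `L_X T = h` in coordinates: both hold on a
ball whose radius does not depend on the point at which the solution is given. -/
theorem exists_ball_flat_continuation {T h : E → E →L[ℝ] E →L[ℝ] ℝ} {s : Set E} (hs : IsOpen s)
    {q : E} (hq : q ∈ s) (hT : ContDiffOn ℝ ω T s) (hh : ContDiffOn ℝ ω h s)
    (hsymm : ∀ x ∈ s, ∀ v w, T x v w = T x w v)
    (hnondeg : ∀ x ∈ s, ∀ v, (∀ w, T x v w = 0) → v = 0) :
    ∃ r > 0, ball q r ⊆ s ∧
      (∀ p ∈ ball q r, ∀ N, IsOpen N → p ∈ N → ∀ X, ContDiffOn ℝ 2 X N →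
        FlatLieDerivEqOn T h X N →
        ∃ Y, ContDiffOn ℝ ω Y (ball q r) ∧ FlatLieDerivEqOn T h Y (ball q r) ∧ Y =ᶠ[𝓝 p] X) ∧
      (∀ p ∈ ball q r, ∀ X Y, ContDiffOn ℝ 2 X (ball q r) → FlatLieDerivEqOn T h X (ball q r) →
        ContDiffOn ℝ 2 Y (ball q r) → FlatLieDerivEqOn T h Y (ball q r) →
        X =ᶠ[𝓝 p] Y → EqOn X Y (ball q r)) := by
  have hinv : ∀ x ∈ s, (T x).IsInvertible := fun x hx =>
    isInvertible_of_nondegenerate (hnondeg x hx)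
  obtain ⟨r₀, hr₀, h₀⟩ := exists_analytic_continuation_of_closed_system
    ((contDiffOn_prolongationLinear hs hT hinv).contDiffAt (hs.mem_nhds hq)).analyticAt
    ((contDiffOn_prolongationConst hs hT hh hinv).contDiffAt (hs.mem_nhds hq)).analyticAt
  obtain ⟨r₁, hr₁, h₁⟩ := Metric.isOpen_iff.1 hs q hq
  have hrs : ball q (min r₀ r₁) ⊆ s := (ball_subset_ball (min_le_right _ _)).trans h₁
  have hr0 : ball q (min r₀ r₁) ⊆ ball q r₀ := ball_subset_ball (min_le_left _ _)
  refine ⟨min r₀ r₁, lt_min hr₀ hr₁, hrs, ?_, ?_⟩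
  · intro p hp N hN hpN X hX hXeq
    -- The system is known only where `X` is a solution, so the comparison with `z` is made on a
    -- small ball (a convex set) around `p`, while `z` lives on the large one.
    obtain ⟨ε, hε, hεN⟩ := Metric.isOpen_iff.1 (hN.inter isOpen_ball) p ⟨hpN, hp⟩
    have hC : ball p ε ⊆ ball q (min r₀ r₁) := fun x hx => (hεN hx).2
    have hCN : ball p ε ⊆ N := fun x hx => (hεN hx).1
    obtain ⟨z, hz, hz'⟩ := h₀ p (hr0 hp) (X p, fderiv ℝ X p)
    have hprol := fun x (hx : x ∈ ball p ε) =>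
      FlatLieDerivEqOn.prolongation isOpen_ball (hT.mono (hC.trans hrs)) (hh.mono (hC.trans hrs))
        (fun x hx => hsymm x (hrs (hC hx))) (fun x hx => hinv x (hrs (hC hx)))
        (hX.mono hCN) (hXeq.mono hCN) hx
    have hEq := hz' (ball p ε) (hC.trans hr0) (convex_ball p ε) (mem_ball_self hε)
      (fun x => (X x, fderiv ℝ X x)) (fun x hx => (hprol x hx).1) (fun x hx => (hprol x hx).2) rfl
    have hY : ContDiffOn ℝ ω (fun x => (z x).1) (ball q (min r₀ r₁)) := (hz.mono hr0).fst
    have hYX : (fun x => (z x).1) =ᶠ[𝓝 p] X := by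
      filter_upwards [ball_mem_nhds p hε] with x hx
      rw [← hEq hx]
    refine ⟨fun x => (z x).1, hY, fun x hx v w => ?_, hYX⟩
    have hT' := hT.mono hrs
    have hdY := hY.fderiv_of_isOpen isOpen_ball (m := ω) le_rfl
    have hdT := hT'.fderiv_of_isOpen isOpen_ball (m := ω) le_rfl
    -- The defect of the equation for the first component of `z` is analytic on the ball and
    -- vanishes near `p`, hence everywhere on the ball.
    have hsm : ContDiffOn ℝ ω (fun x => fderiv ℝ T x (z x).1 v w
        + T x (fderiv ℝ (fun x => (z x).1) x v) w + T x v (fderiv ℝ (fun x => (z x).1) x w)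
        - h x v w) (ball q (min r₀ r₁)) :=
      (((((hdT.clm_apply hY).clm_apply contDiffOn_const).clm_apply contDiffOn_const).add
        ((hT'.clm_apply (hdY.clm_apply contDiffOn_const)).clm_apply contDiffOn_const)).add
        ((hT'.clm_apply contDiffOn_const).clm_apply (hdY.clm_apply contDiffOn_const))).sub
        (((hh.mono hrs).clm_apply contDiffOn_const).clm_apply contDiffOn_const)
    have hzero := AnalyticOnNhd.eqOn_zero_of_preconnected_of_eventuallyEq_zero
      (fun x hx => (hsm.contDiffAt (isOpen_ball.mem_nhds hx)).analyticAt)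
      (convex_ball q (min r₀ r₁)).isPreconnected hp (by
        filter_upwards [hYX.eventuallyEq_nhds, ball_mem_nhds p hε] with x hx hxε
        rw [hx.fderiv_eq, hx.eq_of_nhds, hXeq x (hCN hxε) v w]
        simp)
    exact sub_eq_zero.1 (hzero hx)
  · intro p hp X Y hX hXeq hY hYeq hXY x hx
    -- The germs agree at `p`, so `(X, DX)` and `(Y, DY)` have the same initial value there; both
    -- then equal the same `z` on the whole ball.
    obtain ⟨z, hz, hz'⟩ := h₀ p (hr0 hp) (X p, fderiv ℝ X p)
    have hprol := fun X hX hXeq x (hx : x ∈ ball q (min r₀ r₁)) =>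
      FlatLieDerivEqOn.prolongation (X := X) isOpen_ball (hT.mono hrs) (hh.mono hrs)
        (fun x hx => hsymm x (hrs hx)) (fun x hx => hinv x (hrs hx)) hX hXeq hx
    have hEqX := hz' _ hr0 (convex_ball q _) hp (fun x => (X x, fderiv ℝ X x))
      (fun x hx => (hprol X hX hXeq x hx).1) (fun x hx => (hprol X hX hXeq x hx).2) rfl
    have hEqY := hz' _ hr0 (convex_ball q _) hp (fun x => (Y x, fderiv ℝ Y x))
      (fun x hx => (hprol Y hY hYeq x hx).1) (fun x hx => (hprol Y hY hYeq x hx).2)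
      (by rw [hXY.eq_of_nhds, hXY.fderiv_eq])
    exact congrArg Prod.fst ((hEqX hx).trans (hEqY hx).symm)

end Flat

/-! ### Vector fields, tensors and Lie derivatives in a chart -/

section ChartTransfer

set_option maxSynthPendingDepth 3

open Set Filter

open VectorField

variable {n : ℕ} {M : Type*} [TopologicalSpace M] [ChartedSpace (EuclideanSpace ℝ (Fin n)) M]

/-- The vector field on the manifold represented by the field `V` in the chart at `q`. -/
noncomputable def fieldOfChart (q : M)
    (V : EuclideanSpace ℝ (Fin n) → EuclideanSpace ℝ (Fin n)) (x : M) :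
    TangentSpace (𝓡 n) x :=
  mpullback (𝓡 n) 𝓘(ℝ, EuclideanSpace ℝ (Fin n)) (extChartAt (𝓡 n) q) V x

/-- The representative in the chart at `q` of a vector field. -/
noncomputable def chartField (q : M) (X : ∀ x : M, TangentSpace (𝓡 n) x)
    (u : EuclideanSpace ℝ (Fin n)) : EuclideanSpace ℝ (Fin n) :=
  mpullback 𝓘(ℝ, EuclideanSpace ℝ (Fin n)) (𝓡 n) (extChartAt (𝓡 n) q).symm X u

variable [IsManifold (𝓡 n) ω M]

theorem mfderiv_extChartAt_symm_inverse {q x : M} (hx : x ∈ (extChartAt (𝓡 n) q).source) :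
    (mfderiv 𝓘(ℝ, EuclideanSpace ℝ (Fin n)) (𝓡 n) (extChartAt (𝓡 n) q).symm
      (extChartAt (𝓡 n) q x)).inverse =
      mfderiv (𝓡 n) 𝓘(ℝ, EuclideanSpace ℝ (Fin n)) (extChartAt (𝓡 n) q) x := by
  have h1 := mfderivWithin_extChartAt_symm_comp_mfderiv_extChartAt' (I := 𝓡 n) hx
  have h2 := isInvertible_mfderivWithin_extChartAt_symm (I := 𝓡 n)
    ((extChartAt (𝓡 n) q).map_source hx)
  rw [ModelWithCorners.range_eq_univ, mfderivWithin_univ] at h1 h2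
  obtain ⟨e, he⟩ := h2
  rw [← he] at h1 ⊢
  rw [ContinuousLinearMap.inverse_equiv]
  ext1 v
  have := congrArg (fun L => L v) h1
  exact (e.symm_apply_eq).2 this.symm

theorem chartField_apply {q x : M} (hx : x ∈ (extChartAt (𝓡 n) q).source)
    (X : ∀ x : M, TangentSpace (𝓡 n) x) :
    chartField q X (extChartAt (𝓡 n) q x) =
      mfderiv (𝓡 n) 𝓘(ℝ, EuclideanSpace ℝ (Fin n)) (extChartAt (𝓡 n) q) x (X x) := by
  rw [chartField, mpullback_apply, mfderiv_extChartAt_symm_inverse hx]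
  congr 1
  rw [(extChartAt (𝓡 n) q).left_inv hx]

theorem mfderiv_fieldOfChart {q x : M} (hx : x ∈ (extChartAt (𝓡 n) q).source)
    (V : EuclideanSpace ℝ (Fin n) → EuclideanSpace ℝ (Fin n)) :
    mfderiv (𝓡 n) 𝓘(ℝ, EuclideanSpace ℝ (Fin n)) (extChartAt (𝓡 n) q) x (fieldOfChart q V x) =
      V (extChartAt (𝓡 n) q x) := by
  obtain ⟨e, he⟩ := isInvertible_mfderiv_extChartAt (I := 𝓡 n) hx
  change mfderiv (𝓡 n) 𝓘(ℝ, EuclideanSpace ℝ (Fin n)) (extChartAt (𝓡 n) q) x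
    ((mfderiv (𝓡 n) 𝓘(ℝ, EuclideanSpace ℝ (Fin n)) (extChartAt (𝓡 n) q) x).inverse
      (V (extChartAt (𝓡 n) q x))) = _
  rw [← he, ContinuousLinearMap.inverse_equiv]
  exact e.apply_symm_apply _

theorem eq_of_mfderiv_extChartAt_eq {q x : M} (hx : x ∈ (extChartAt (𝓡 n) q).source)
    {v w : TangentSpace (𝓡 n) x}
    (h : mfderiv (𝓡 n) 𝓘(ℝ, EuclideanSpace ℝ (Fin n)) (extChartAt (𝓡 n) q) x v =
      mfderiv (𝓡 n) 𝓘(ℝ, EuclideanSpace ℝ (Fin n)) (extChartAt (𝓡 n) q) x w) : v = w :=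
  (isInvertible_mfderiv_extChartAt (I := 𝓡 n) hx).injective h

theorem fieldOfChart_chartField {q x : M} (hx : x ∈ (extChartAt (𝓡 n) q).source)
    (X : ∀ x : M, TangentSpace (𝓡 n) x) : fieldOfChart q (chartField q X) x = X x :=
  eq_of_mfderiv_extChartAt_eq hx (by rw [mfderiv_fieldOfChart hx, chartField_apply hx])

theorem chartField_fieldOfChart {q : M} {u : EuclideanSpace ℝ (Fin n)}
    (hu : u ∈ (extChartAt (𝓡 n) q).target)
    (V : EuclideanSpace ℝ (Fin n) → EuclideanSpace ℝ (Fin n)) :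
    chartField q (fieldOfChart q V) u = V u := by
  obtain ⟨x, hx, rfl⟩ := (extChartAt (𝓡 n) q).surjOn hu
  rw [chartField_apply hx, mfderiv_fieldOfChart hx]

theorem fieldOfChart_contMDiffAt {q p : M} (hp : p ∈ (extChartAt (𝓡 n) q).source)
    {V : EuclideanSpace ℝ (Fin n) → EuclideanSpace ℝ (Fin n)}
    {k : ℕ∞ω} (hV : ContDiffAt ℝ k V (extChartAt (𝓡 n) q p)) :
    ContMDiffAt (𝓡 n) (𝓡 n).tangent k
      (fun x => (⟨x, fieldOfChart q V x⟩ : TangentBundle (𝓡 n) M)) p := by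
  have : IsManifold (𝓡 n) 1 M := .of_le le_top
  refine ContMDiffAt.mpullback_vectorField_preimage (n := ω) (f := extChartAt (𝓡 n) q) (V := V)
    (contMDiffAt_vectorSpace_iff_contDiffAt.2 hV) ?_ (isInvertible_mfderiv_extChartAt hp) le_top
  exact contMDiffAt_extChartAt' (by simpa using hp)

theorem chartField_contDiffAt {q p : M} (hp : p ∈ (extChartAt (𝓡 n) q).source)
    {X : ∀ x : M, TangentSpace (𝓡 n) x} {k : ℕ∞ω}
    (hX : ContMDiffAt (𝓡 n) (𝓡 n).tangent k (fun x => (⟨x, X x⟩ : TangentBundle (𝓡 n) M)) p) :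
    ContDiffAt ℝ k (chartField q X) (extChartAt (𝓡 n) q p) := by
  have : IsManifold (𝓡 n) 1 M := .of_le le_top
  have hu := (extChartAt (𝓡 n) q).map_source hp
  refine contMDiffAt_vectorSpace_iff_contDiffAt.1 ?_
  refine ContMDiffAt.mpullback_vectorField_preimage (n := ω) (V := X)
    (by rwa [(extChartAt (𝓡 n) q).left_inv hp]) ?_ ?_ le_top
  · exact (contMDiffOn_extChartAt_symm q).contMDiffAt
      ((isOpen_extChartAt_target q).mem_nhds hu)
  · have := isInvertible_mfderivWithin_extChartAt_symm (I := 𝓡 n) hu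
    rwa [ModelWithCorners.range_eq_univ, mfderivWithin_univ] at this

/-- The representative in the chart at `q` of a `(0,2)`-tensor field. -/
noncomputable def chartTensor (q : M)
    (T : ∀ x : M, TangentSpace (𝓡 n) x →L[ℝ] TangentSpace (𝓡 n) x →L[ℝ] ℝ)
    (u : EuclideanSpace ℝ (Fin n)) :
    EuclideanSpace ℝ (Fin n) →L[ℝ] EuclideanSpace ℝ (Fin n) →L[ℝ] ℝ :=
  ContinuousLinearMap.bilinearComp
    (show EuclideanSpace ℝ (Fin n) →L[ℝ] EuclideanSpace ℝ (Fin n) →L[ℝ] ℝ from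
      T ((extChartAt (𝓡 n) q).symm u))
    (show EuclideanSpace ℝ (Fin n) →L[ℝ] EuclideanSpace ℝ (Fin n) from
      mfderiv 𝓘(ℝ, EuclideanSpace ℝ (Fin n)) (𝓡 n) (extChartAt (𝓡 n) q).symm u)
    (show EuclideanSpace ℝ (Fin n) →L[ℝ] EuclideanSpace ℝ (Fin n) from
      mfderiv 𝓘(ℝ, EuclideanSpace ℝ (Fin n)) (𝓡 n) (extChartAt (𝓡 n) q).symm u)

theorem mfderiv_extChartAt_symm_chartField {q x : M} (hx : x ∈ (extChartAt (𝓡 n) q).source)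
    (X : ∀ x : M, TangentSpace (𝓡 n) x) :
    mfderiv 𝓘(ℝ, EuclideanSpace ℝ (Fin n)) (𝓡 n) (extChartAt (𝓡 n) q).symm (extChartAt (𝓡 n) q x)
      (chartField q X (extChartAt (𝓡 n) q x)) = X x := by
  have h1 := mfderivWithin_extChartAt_symm_comp_mfderiv_extChartAt' (I := 𝓡 n) hx
  rw [ModelWithCorners.range_eq_univ, mfderivWithin_univ] at h1
  rw [chartField_apply hx]
  exact congrArg (fun L => L (X x)) h1

theorem chartTensor_apply {q x : M} (hx : x ∈ (extChartAt (𝓡 n) q).source)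
    (T : ∀ x : M, TangentSpace (𝓡 n) x →L[ℝ] TangentSpace (𝓡 n) x →L[ℝ] ℝ)
    (Y Z : ∀ x : M, TangentSpace (𝓡 n) x) :
    chartTensor q T (extChartAt (𝓡 n) q x) (chartField q Y (extChartAt (𝓡 n) q x))
      (chartField q Z (extChartAt (𝓡 n) q x)) = T x (Y x) (Z x) := by
  -- `T` at `φ⁻¹(φ x)` and `T` at `x` act on formally different tangent spaces; both are the model
  -- space by definition, so vectors of the model space can be fed to either.
  have key : ∀ y, y = x → ∀ v w : EuclideanSpace ℝ (Fin n), T y v w = T x v w := by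
    rintro _ rfl v w
    rfl
  refine (key _ ((extChartAt (𝓡 n) q).left_inv hx) _ _).trans ?_
  exact congrArg₂ (fun v w : EuclideanSpace ℝ (Fin n) => T x v w)
    (mfderiv_extChartAt_symm_chartField hx Y)
    (mfderiv_extChartAt_symm_chartField hx Z)

theorem chartTensor_apply_fieldOfChart {q x : M} (hx : x ∈ (extChartAt (𝓡 n) q).source)
    (T : ∀ x : M, TangentSpace (𝓡 n) x →L[ℝ] TangentSpace (𝓡 n) x →L[ℝ] ℝ)
    (v w : EuclideanSpace ℝ (Fin n)) :
    chartTensor q T (extChartAt (𝓡 n) q x) v w =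
      T x (fieldOfChart q (fun _ => v) x) (fieldOfChart q (fun _ => w) x) := by
  rw [← chartTensor_apply hx, chartField_fieldOfChart ((extChartAt (𝓡 n) q).map_source hx),
    chartField_fieldOfChart ((extChartAt (𝓡 n) q).map_source hx)]

/-- The components are `T` evaluated on the coordinate fields of constant vectors, which are
analytic on the chart domain. -/
theorem chartTensor_contDiffOn (q : M)
    {T : ∀ x : M, TangentSpace (𝓡 n) x →L[ℝ] TangentSpace (𝓡 n) x →L[ℝ] ℝ}
    (hT : ContMDiff (𝓡 n)
      ((𝓡 n).prod 𝓘(ℝ, EuclideanSpace ℝ (Fin n) →L[ℝ] EuclideanSpace ℝ (Fin n) →L[ℝ] ℝ)) ω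
      (fun x => Bundle.TotalSpace.mk'
        (EuclideanSpace ℝ (Fin n) →L[ℝ] EuclideanSpace ℝ (Fin n) →L[ℝ] ℝ)
        (E := fun x : M => TangentSpace (𝓡 n) x →L[ℝ] TangentSpace (𝓡 n) x →L[ℝ] ℝ) x (T x))) :
    ContDiffOn ℝ ω (chartTensor q T) (extChartAt (𝓡 n) q).target := by
  refine contDiffOn_clm_apply.2 fun v => contDiffOn_clm_apply.2 fun w => ?_
  have hsm : ContMDiffOn (𝓡 n) 𝓘(ℝ) ω (fun x => T x (fieldOfChart q (fun _ => v) x)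
      (fieldOfChart q (fun _ => w) x)) (extChartAt (𝓡 n) q).source := by
    intro x hx
    have : ContMDiffAt (𝓡 n) ((𝓡 n).prod 𝓘(ℝ)) ω
        (fun x => Bundle.TotalSpace.mk' ℝ (E := Bundle.Trivial M ℝ) x
          (T x (fieldOfChart q (fun _ => v) x) (fieldOfChart q (fun _ => w) x))) x := by
      apply ContMDiffAt.clm_bundle_apply₂ (F₁ := EuclideanSpace ℝ (Fin n))
        (F₂ := EuclideanSpace ℝ (Fin n))
      · exact hT.contMDiffAt
      · exact fieldOfChart_contMDiffAt hx contDiffAt_const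
      · exact fieldOfChart_contMDiffAt hx contDiffAt_const
    rw [Bundle.contMDiffAt_totalSpace] at this
    exact this.2.contMDiffWithinAt
  refine (contMDiffOn_iff_contDiffOn.1 (hsm.comp (contMDiffOn_extChartAt_symm q)
    fun u hu => (extChartAt (𝓡 n) q).map_target hu)).congr fun u hu => ?_
  obtain ⟨x, hx, rfl⟩ := (extChartAt (𝓡 n) q).surjOn hu
  rw [chartTensor_apply_fieldOfChart hx, Function.comp_apply, (extChartAt (𝓡 n) q).left_inv hx]

/-- The bracket is natural under pullback by the inverse chart, and in a vector space it is `DY X -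
DX Y`. -/
theorem chartField_mlieBracket {q p : M} (hp : p ∈ (extChartAt (𝓡 n) q).source)
    {X Y : ∀ x : M, TangentSpace (𝓡 n) x}
    (hX : MDifferentiableAt (𝓡 n) (𝓡 n).tangent (fun x => (⟨x, X x⟩ : TangentBundle (𝓡 n) M)) p)
    (hY : MDifferentiableAt (𝓡 n) (𝓡 n).tangent (fun x => (⟨x, Y x⟩ : TangentBundle (𝓡 n) M)) p) :
    chartField q (mlieBracket (𝓡 n) X Y) (extChartAt (𝓡 n) q p) =
      fderiv ℝ (chartField q Y) (extChartAt (𝓡 n) q p) (chartField q X (extChartAt (𝓡 n) q p)) -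
      fderiv ℝ (chartField q X) (extChartAt (𝓡 n) q p) (chartField q Y (extChartAt (𝓡 n) q p)) := by
  have : IsManifold (𝓡 n) (minSmoothness ℝ 3) M := .of_le le_top
  have hl := (extChartAt (𝓡 n) q).left_inv hp
  refine (mpullback_mlieBracket (n := ω) (by rwa [hl]) (by rwa [hl])
    ((contMDiffOn_extChartAt_symm q).contMDiffAt
      ((isOpen_extChartAt_target q).mem_nhds ((extChartAt (𝓡 n) q).map_source hp))) le_top).trans
    ((congrFun (mlieBracketWithin_eq_lieBracketWithin (s := univ)) _).trans
      (congrFun (lieBracketWithin_univ (E := EuclideanSpace ℝ (Fin n))) _))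

/-- The Lie derivative of a `(0,2)`-tensor field in a chart. -/
theorem lieDerivEval_eq {q p : M} (hp : p ∈ (extChartAt (𝓡 n) q).source)
    {T : ∀ x : M, TangentSpace (𝓡 n) x →L[ℝ] TangentSpace (𝓡 n) x →L[ℝ] ℝ}
    (hT : DifferentiableAt ℝ (chartTensor q T) (extChartAt (𝓡 n) q p))
    {X Y Z : ∀ x : M, TangentSpace (𝓡 n) x}
    (hX : ContMDiffAt (𝓡 n) (𝓡 n).tangent 1 (fun x => (⟨x, X x⟩ : TangentBundle (𝓡 n) M)) p)
    (hY : ContMDiffAt (𝓡 n) (𝓡 n).tangent 1 (fun x => (⟨x, Y x⟩ : TangentBundle (𝓡 n) M)) p)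
    (hZ : ContMDiffAt (𝓡 n) (𝓡 n).tangent 1 (fun x => (⟨x, Z x⟩ : TangentBundle (𝓡 n) M)) p) :
    lieDerivEval X T Y Z p =
      fderiv ℝ (chartTensor q T) (extChartAt (𝓡 n) q p) (chartField q X (extChartAt (𝓡 n) q p))
        (chartField q Y (extChartAt (𝓡 n) q p)) (chartField q Z (extChartAt (𝓡 n) q p)) +
      chartTensor q T (extChartAt (𝓡 n) q p)
        (fderiv ℝ (chartField q X) (extChartAt (𝓡 n) q p) (chartField q Y (extChartAt (𝓡 n) q p)))
        (chartField q Z (extChartAt (𝓡 n) q p)) +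
      chartTensor q T (extChartAt (𝓡 n) q p) (chartField q Y (extChartAt (𝓡 n) q p))
        (fderiv ℝ (chartField q X) (extChartAt (𝓡 n) q p)
          (chartField q Z (extChartAt (𝓡 n) q p))) := by
  have hXd := hX.mdifferentiableAt one_ne_zero
  have hYd := hY.mdifferentiableAt one_ne_zero
  have hZd := hZ.mdifferentiableAt one_ne_zero
  have hYc := (chartField_contDiffAt hp hY).differentiableAt one_ne_zero
  have hZc := (chartField_contDiffAt hp hZ).differentiableAt one_ne_zero
  obtain ⟨D, hD, hDV⟩ := hasFDerivAt_bilinear_apply hT.hasFDerivAt hYc.hasFDerivAt hZc.hasFDerivAt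
  have h1 : mvfderiv (𝓡 n) (fun x => T x (Y x) (Z x)) p (X p) =
      D (chartField q X (extChartAt (𝓡 n) q p)) := by
    have hev : (fun x => T x (Y x) (Z x)) =ᶠ[𝓝 p] (fun u => chartTensor q T u
        (chartField q Y u) (chartField q Z u)) ∘ extChartAt (𝓡 n) q := by
      filter_upwards [(isOpen_extChartAt_source (I := 𝓡 n) q).mem_nhds hp] with x hx
      exact (chartTensor_apply hx T Y Z).symm
    have hφ : HasMFDerivAt (𝓡 n) 𝓘(ℝ, EuclideanSpace ℝ (Fin n)) (extChartAt (𝓡 n) q) p _ :=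
      (contMDiffAt_extChartAt' (n := ω) (by simpa using hp)).mdifferentiableAt
        (by simp) |>.hasMFDerivAt
    have hc := (hD.hasMFDerivAt.comp p hφ).congr_of_eventuallyEq hev
    rw [chartField_apply hp]
    change mfderiv (𝓡 n) 𝓘(ℝ) (fun x => T x (Y x) (Z x)) p (X p) = _
    rw [hc.mfderiv]
    rfl
  -- The product rule produces derivatives of `Y` and `Z`; the brackets cancel them, and only
  -- derivatives of `T` and `X` survive.
  rw [lieDerivEval, h1, hDV, ← chartTensor_apply hp T (mlieBracket (𝓡 n) X Y) Z,
    ← chartTensor_apply hp T Y (mlieBracket (𝓡 n) X Z), chartField_mlieBracket hp hXd hYd,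
    chartField_mlieBracket hp hXd hZd, map_sub, map_sub, _root_.sub_apply]
  ring

end ChartTransfer

/-! ### The locally constant sheaf of `h`-Killing fields and the global extension -/

section KillingFields

set_option maxSynthPendingDepth 3

open Set Filter

open VectorField

variable {n : ℕ} {M : Type*} [TopologicalSpace M] [ChartedSpace (EuclideanSpace ℝ (Fin n)) M]

theorem fieldOfChart_congr (q : M) {V W : EuclideanSpace ℝ (Fin n) → EuclideanSpace ℝ (Fin n)}
    {x : M} (h : V (extChartAt (𝓡 n) q x) = W (extChartAt (𝓡 n) q x)) :
    fieldOfChart q V x = fieldOfChart q W x :=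
  congrArg (mfderiv (𝓡 n) 𝓘(ℝ, EuclideanSpace ℝ (Fin n)) (extChartAt (𝓡 n) q) x).inverse h

theorem chartField_congr (q : M) {X Y : ∀ x : M, TangentSpace (𝓡 n) x}
    {u : EuclideanSpace ℝ (Fin n)}
    (h : X ((extChartAt (𝓡 n) q).symm u) = Y ((extChartAt (𝓡 n) q).symm u)) :
    chartField q X u = chartField q Y u :=
  congrArg
    (mfderiv 𝓘(ℝ, EuclideanSpace ℝ (Fin n)) (𝓡 n) (extChartAt (𝓡 n) q).symm u).inverse h

/-- Vector fields appear here as plain functions into the model space, which every tangent space is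
by definition; this lets the sheaf of functions and its germs apply to them. -/
theorem lieDerivEval_congr {X X' : M → EuclideanSpace ℝ (Fin n)} {p : M} (hX : X =ᶠ[𝓝 p] X')
    (T : ∀ x : M, TangentSpace (𝓡 n) x →L[ℝ] TangentSpace (𝓡 n) x →L[ℝ] ℝ)
    (Y Z : ∀ x : M, TangentSpace (𝓡 n) x) :
    lieDerivEval X T Y Z p = lieDerivEval X' T Y Z p := by
  have hb (Y : ∀ x : M, TangentSpace (𝓡 n) x) :
      mlieBracket (𝓡 n) X Y p = mlieBracket (𝓡 n) X' Y p :=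
    Filter.EventuallyEq.mlieBracket_vectorField_eq hX .rfl
  have h0 : mvfderiv (𝓡 n) (fun x => T x (Y x) (Z x)) p (X p) =
      mvfderiv (𝓡 n) (fun x => T x (Y x) (Z x)) p (X' p) :=
    congrArg (mvfderiv (𝓡 n) (fun x => T x (Y x) (Z x)) p) hX.eq_of_nhds
  unfold lieDerivEval
  rw [hb, hb, h0]

variable [IsManifold (𝓡 n) ω M]

/-- The equation `L_X T = h` inside a chart domain in terms of the representatives. -/
theorem lieDerivEqOn_iff_flat {q : M} {N : Set M} (hN : IsOpen N)
    (hNs : N ⊆ (extChartAt (𝓡 n) q).source)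
    {T h : ∀ x : M, TangentSpace (𝓡 n) x →L[ℝ] TangentSpace (𝓡 n) x →L[ℝ] ℝ}
    (hT : ContDiffOn ℝ ω (chartTensor q T) (extChartAt (𝓡 n) q).target)
    {X : ∀ x : M, TangentSpace (𝓡 n) x} (hX : IsCkVectorFieldOn 1 X N) :
    LieDerivEqOn X T h N ↔ FlatLieDerivEqOn (chartTensor q T) (chartTensor q h) (chartField q X)
      ((extChartAt (𝓡 n) q).target ∩ (extChartAt (𝓡 n) q).symm ⁻¹' N) := by
  have hTd : ∀ x ∈ N, DifferentiableAt ℝ (chartTensor q T) (extChartAt (𝓡 n) q x) := fun x hx =>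
    (hT.differentiableOn (by simp)).differentiableAt
      ((isOpen_extChartAt_target q).mem_nhds ((extChartAt (𝓡 n) q).map_source (hNs hx)))
  have hXd : ∀ x ∈ N, ContMDiffAt (𝓡 n) (𝓡 n).tangent 1
      (fun x => (⟨x, X x⟩ : TangentBundle (𝓡 n) M)) x :=
    fun x hx => hX.contMDiffAt (hN.mem_nhds hx)
  constructor
  -- It suffices to test on the fields that are constant in the chart.
  · rintro H u ⟨hu, huN⟩ v w
    obtain ⟨x, hx, rfl⟩ := (extChartAt (𝓡 n) q).surjOn hu
    have hxN : x ∈ N := by rwa [mem_preimage, (extChartAt (𝓡 n) q).left_inv hx] at huN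
    have hsm (v : EuclideanSpace ℝ (Fin n)) {k : ℕ∞ω} :=
      fieldOfChart_contMDiffAt (k := k) hx (contDiffAt_const (c := v))
    have h0 := H x hxN _ _ (hsm v) (hsm w)
    rwa [lieDerivEval_eq hx (hTd x hxN) (hXd x hxN) (hsm v) (hsm w),
      chartField_fieldOfChart hu, chartField_fieldOfChart hu,
      ← chartTensor_apply_fieldOfChart hx] at h0
  -- In the chart formula `Y` and `Z` enter only through their values at `p`, so the identity for
  -- constant vectors covers all fields.
  · intro H p hp Y Z hY hZ
    have hps := hNs hp
    rw [lieDerivEval_eq hps (hTd p hp) (hXd p hp) (hY.of_le (by simp)) (hZ.of_le (by simp)),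
      H _ ⟨(extChartAt (𝓡 n) q).map_source hps, ?_⟩, chartTensor_apply hps]
    rwa [mem_preimage, (extChartAt (𝓡 n) q).left_inv hps]

variable {g : Bundle.ContMDiffRiemannianMetric (𝓡 n) ω (EuclideanSpace ℝ (Fin n))
      (fun x : M => TangentSpace (𝓡 n) x)}
  {h : ∀ x : M, TangentSpace (𝓡 n) x →L[ℝ] TangentSpace (𝓡 n) x →L[ℝ] ℝ}

theorem IsHKillingOn.mono {k : ℕ∞ω} {X : ∀ x : M, TangentSpace (𝓡 n) x} {s t : Set M}
    (hX : IsHKillingOn k g h X s) (hts : t ⊆ s) : IsHKillingOn k g h X t :=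
  ⟨ContMDiffOn.mono hX.1 hts, fun p hp => hX.2 p (hts hp)⟩

theorem IsHKillingOn.of_le {k l : ℕ∞ω} {X : ∀ x : M, TangentSpace (𝓡 n) x} {s : Set M}
    (hX : IsHKillingOn k g h X s) (hlk : l ≤ k) : IsHKillingOn l g h X s :=
  ⟨ContMDiffOn.of_le hX.1 hlk, hX.2⟩

theorem IsHKillingOn.of_locally_eq {k : ℕ∞ω} {X : M → EuclideanSpace ℝ (Fin n)} {s : Set M}
    (H : ∀ x ∈ s, ∃ V, IsOpen V ∧ x ∈ V ∧ ∃ Y : M → EuclideanSpace ℝ (Fin n),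
      IsHKillingOn k g h Y V ∧ X =ᶠ[𝓝 x] Y) : IsHKillingOn k g h X s := by
  constructor
  · intro x hx
    obtain ⟨V, hV, hxV, Y, hY, hXY⟩ := H x hx
    refine ((ContMDiffOn.contMDiffAt hY.1 (hV.mem_nhds hxV)).congr_of_eventuallyEq
      ?_).contMDiffWithinAt
    filter_upwards [hXY] with y hy
    exact congrArg (fun v : EuclideanSpace ℝ (Fin n) => (⟨y, v⟩ : TangentBundle (𝓡 n) M)) hy
  · intro x hx Y' Z' hY' hZ'
    obtain ⟨V, hV, hxV, Y, hY, hXY⟩ := H x hx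
    rw [lieDerivEval_congr hXY]
    exact hY.2 x hxV Y' Z' hY' hZ'

theorem chartTensor_metric_nondegenerate {q : M} {u : EuclideanSpace ℝ (Fin n)}
    (hu : u ∈ (extChartAt (𝓡 n) q).target) {v : EuclideanSpace ℝ (Fin n)}
    (hv : ∀ w, chartTensor q g.inner u v w = 0) : v = 0 := by
  obtain ⟨x, hx, rfl⟩ := (extChartAt (𝓡 n) q).surjOn hu
  by_contra hv0
  have hpos := g.pos x (fieldOfChart q (fun _ => v) x) fun h0 => hv0 <| by
    have := mfderiv_fieldOfChart hx (fun _ => v)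
    rw [h0, map_zero] at this
    exact this.symm
  rw [← chartTensor_apply_fieldOfChart hx, hv] at hpos
  exact lt_irrefl _ hpos

/-- Every point has a neighbourhood to which germs of `h`-Killing fields extend uniquely. -/
theorem exists_nhds_hKilling_continuation (hh : IsAnalyticSymmTensor h) (q : M) :
    ∃ W, IsOpen W ∧ q ∈ W ∧
      (∀ p ∈ W, ∀ N, IsOpen N → p ∈ N → ∀ X : M → EuclideanSpace ℝ (Fin n),
        IsHKillingOn 2 g h X N →
        ∃ Y : M → EuclideanSpace ℝ (Fin n), IsHKillingOn ω g h Y W ∧ Y =ᶠ[𝓝 p] X) ∧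
      (∀ p ∈ W, ∀ X Y : M → EuclideanSpace ℝ (Fin n), IsHKillingOn 2 g h X W →
        IsHKillingOn 2 g h Y W → X =ᶠ[𝓝 p] Y → EqOn X Y W) := by
  set φ := extChartAt (𝓡 n) q with hφ
  have hgT := chartTensor_contDiffOn q g.contMDiff
  obtain ⟨r, hr, hball, hext, huniq⟩ := exists_ball_flat_continuation
    (isOpen_extChartAt_target q) (mem_extChartAt_target q) hgT
    (chartTensor_contDiffOn q hh.analytic)
    (fun u hu v w => by
      obtain ⟨x, hx, rfl⟩ := φ.surjOn hu
      rw [chartTensor_apply_fieldOfChart hx, chartTensor_apply_fieldOfChart hx, g.symm])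
    (fun u hu v hv => chartTensor_metric_nondegenerate hu hv)
  have hcd : ∀ {N : Set M} {X : M → EuclideanSpace ℝ (Fin n)}, IsOpen N →
      IsHKillingOn 2 g h X N →
      ContDiffOn ℝ 2 (chartField q X) (φ.target ∩ φ.symm ⁻¹' N) := by
    rintro N X hN hX u ⟨hu, huN⟩
    obtain ⟨x, hx, rfl⟩ := φ.surjOn hu
    rw [mem_preimage, φ.left_inv hx] at huN
    exact (chartField_contDiffAt hx
      (ContMDiffOn.contMDiffAt hX.1 (hN.mem_nhds huN))).contDiffWithinAt
  have hflat : ∀ {N : Set M} {X : M → EuclideanSpace ℝ (Fin n)}, IsOpen N → N ⊆ φ.source →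
      IsHKillingOn 2 g h X N →
      FlatLieDerivEqOn (chartTensor q g.inner) (chartTensor q h) (chartField q X)
        (φ.target ∩ φ.symm ⁻¹' N) := fun hN hNs hX =>
    (lieDerivEqOn_iff_flat hN hNs hgT (hX.of_le (by norm_num)).1).1 hX.2
  have hopen : ∀ {N : Set M}, IsOpen N → IsOpen (φ.target ∩ φ.symm ⁻¹' N) := fun hN =>
    (continuousOn_extChartAt_symm q).isOpen_inter_preimage (isOpen_extChartAt_target q) hN
  set W := φ.source ∩ φ ⁻¹' Metric.ball (φ q) r with hW
  have hWo : IsOpen W := (continuousOn_extChartAt q).isOpen_inter_preimage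
    (isOpen_extChartAt_source q) Metric.isOpen_ball
  have hWball : φ.target ∩ φ.symm ⁻¹' W = Metric.ball (φ q) r := by
    ext u
    constructor
    · rintro ⟨hu, -, hu'⟩
      rwa [mem_preimage, φ.right_inv hu] at hu'
    · intro hu
      have hut := hball hu
      exact ⟨hut, φ.map_target hut, by rwa [mem_preimage, φ.right_inv hut]⟩
  refine ⟨W, hWo, ⟨mem_extChartAt_source q, Metric.mem_ball_self hr⟩, ?_, ?_⟩
  · rintro p ⟨hps, hpb⟩ N hN hpN X hX
    -- The domain of `X` may leave the chart; only the germ at `p` matters.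
    have hN' : IsOpen (N ∩ φ.source) := hN.inter (isOpen_extChartAt_source q)
    have hX' := hX.mono (inter_subset_left (t := φ.source))
    obtain ⟨Y, hYs, hYf, hYX⟩ := hext (φ p) hpb _ (hopen hN')
      ⟨φ.map_source hps, by rw [mem_preimage, φ.left_inv hps]; exact ⟨hpN, hps⟩⟩ _
      (hcd hN' hX') (hflat hN' inter_subset_right hX')
    have hYW : IsCkVectorFieldOn ω (fieldOfChart q Y) W := fun x hx =>
      (fieldOfChart_contMDiffAt hx.1
        (hYs.contDiffAt (Metric.isOpen_ball.mem_nhds hx.2))).contMDiffWithinAt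
    refine ⟨fieldOfChart q Y, ⟨hYW, ?_⟩, ?_⟩
    · refine (lieDerivEqOn_iff_flat hWo inter_subset_left hgT
        (ContMDiffOn.of_le hYW le_top)).2 ?_
      rw [← hφ, hWball]
      exact hYf.congr Metric.isOpen_ball fun u hu => chartField_fieldOfChart (hball hu) Y
    · filter_upwards [(continuousAt_extChartAt' hps).eventually hYX,
        (isOpen_extChartAt_source q).mem_nhds hps] with x hx hxs
      exact (fieldOfChart_congr q hx).trans (fieldOfChart_chartField hxs X)
  · rintro p ⟨hps, hpb⟩ X Y hX hY hXY x hx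
    have hXc := hcd hWo hX
    have hYc := hcd hWo hY
    have hXf := hflat hWo inter_subset_left hX
    have hYf := hflat hWo inter_subset_left hY
    rw [hWball] at hXc hYc hXf hYf
    have hev : chartField q X =ᶠ[𝓝 (φ p)] chartField q Y := by
      have hXY' : ∀ᶠ y in 𝓝 (φ.symm (φ p)), X y = Y y := by rwa [φ.left_inv hps]
      filter_upwards [(continuousAt_extChartAt_symm' hps).eventually hXY'] with u hu
      exact chartField_congr q hu
    have := huniq (φ p) hpb _ _ hXc hXf hYc hYf hev hx.2
    exact (fieldOfChart_chartField hx.1 X).symm.trans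
      ((fieldOfChart_congr q this).trans (fieldOfChart_chartField hx.1 Y))

/-- `h`-Killing fields of class `C^2` are analytic. -/
theorem IsHKillingOn.analytic (hh : IsAnalyticSymmTensor h) {k : ℕ∞ω} (hk : 2 ≤ k)
    {X : M → EuclideanSpace ℝ (Fin n)} {U : Set M} (hU : IsOpen U)
    (hX : IsHKillingOn k g h X U) : IsHKillingOn ω g h X U := by
  refine .of_locally_eq fun x hx => ?_
  obtain ⟨W, hW, hxW, hext, -⟩ := exists_nhds_hKilling_continuation (g := g) hh x
  -- The analytic field that continues the germ of `X` at `x` agrees with `X` near `x`.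
  obtain ⟨Y, hY, hYX⟩ := hext x hxW U hU hx X (hX.of_le hk)
  exact ⟨W, hW, hxW, Y, hY, hYX.symm⟩

/-- Class `ω` makes the sheaf independent of `k`: a field of class `C^k` with `2 ≤ k` is a section
of it by `IsHKillingOn.analytic`. -/
theorem isLocallyConstantSheaf_hKilling (hh : IsAnalyticSymmTensor h) :
    IsLocallyConstantSheaf fun (X : M → EuclideanSpace ℝ (Fin n)) U => IsHKillingOn ω g h X U where
  mono _ hVU hX := hX.mono hVU
  local' _ H := .of_locally_eq fun x hx => by
    obtain ⟨V, hV, hxV, Y, hY, hXY⟩ := H x hx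
    exact ⟨V, hV, hxV, Y, hY, hXY.eventuallyEq_of_mem (hV.mem_nhds hxV)⟩
  exists_extension q := by
    obtain ⟨W, hW, hqW, hext, huniq⟩ := exists_nhds_hKilling_continuation (g := g) hh q
    exact ⟨W, hW, hqW, fun p hp N hN hpN X hX => hext p hp N hN hpN X (hX.of_le le_top),
      fun p hp X Y hX hY => huniq p hp X Y (hX.of_le le_top) (hY.of_le le_top)⟩

end KillingFields

theorem mainTheorem5 {n : ℕ} {M : Type*} [TopologicalSpace M] [T2Space M] [ConnectedSpace M]
    [ChartedSpace (EuclideanSpace ℝ (Fin n)) M] [IsManifold (𝓡 n) ω M]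
    (g : Bundle.ContMDiffRiemannianMetric (𝓡 n) ω (EuclideanSpace ℝ (Fin n))
      (fun x : M => TangentSpace (𝓡 n) x))
    (h : ∀ x : M, TangentSpace (𝓡 n) x →L[ℝ] TangentSpace (𝓡 n) x →L[ℝ] ℝ)
    (hh : IsAnalyticSymmTensor h)
    (Ω : Set M) (hΩ_open : IsOpen Ω) (hΩ_conn : IsConnected Ω)
    (hΩ_pi : RelFundamentalGroupTrivial Ω)
    (k : ℕ∞ω) (hk : 2 ≤ k)
    (X : ∀ x : M, TangentSpace (𝓡 n) x) (hX : IsHKillingOn k g h X Ω) :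
    ∃! Xhat : ∀ x : M, TangentSpace (𝓡 n) x,
      IsHKillingOn k g h Xhat Set.univ ∧ ∀ x ∈ Ω, Xhat x = X x := by
  have : LocallyPathConnectedSpace M :=
    ChartedSpace.locallyPathConnectedSpace (EuclideanSpace ℝ (Fin n)) M
  have : PathConnectedSpace M := pathConnectedSpace_iff_connectedSpace.2 inferInstance
  have hS := isLocallyConstantSheaf_hKilling (g := g) hh
  obtain ⟨Y, hY, hYX⟩ := hS.exists_extension_univ hΩ_open hΩ_pi (hX.analytic hh hk hΩ_open)
  refine ⟨Y, ⟨hY.of_le le_top, hYX⟩, fun Z ⟨hZ, hZX⟩ => ?_⟩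
  -- A competitor of class `C^k` is also analytic, so unique continuation in the sheaf applies to
  -- it.
  exact hS.eq_of_eqOn (hZ.analytic hh hk isOpen_univ) hY hΩ_open hΩ_conn.nonempty
    fun x hx => (hZX x hx).trans (hYX hx).symm
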